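/- **Theorem (formula for a region of type D).** Let $q$ be an indeterminate over $\mathbb{Q}$ or, more generally, a non-zero element of a field of characteristic $0$ such that $[k]_{q^2}\neq 0$ for all $k\ge 1$, where $[k]_r:=1+r+\dots+r^{k-1}$ and $[k]_r!:=[1]_r[2]_r\cdots[k]_r$. Let $x,u,n$ be non-negative integers with $n\le u$ and let $1\le h_1<h_2<\dots<h_n\le u$ be integers. *The region.* On the triangular lattice (with horizontal lattice lines) use coordinates $(i,j)$ in which the unit of the horizontal coordinate $i$ is half the length of a unit edge and the unit of the vertical coordinate $j$ is half the height of a vertical lozenge (a vertical lozenge is the union of an up-pointing unit triangle and the down-pointing unit triangle below it that share a horizontal edge). Consider the halved hexagon with upper left vertex $(0,2u+1)$ whose north, northeast, southeast and south sides follow lattice lines and have lengths $x,\ 2u-n+1,\ n,\ x+u-n$, and whose west side, read from the top, consists of $2u$ unit steps going alternately to the lower left and to the lower right, followed by one more unit step to the lower right (so that the bottom-most segment of the zigzag has length $2$); its south side lies on $j=0$. The west side has $u$ bumps, labelled $1,\dots,u$ from bottom to top; each consists of an up-pointing unit triangle and the down-pointing unit triangle below it. For every $k\in\{1,\dots,u\}\setminus\{h_1,\dots,h_n\}$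 remove the up-pointing unit triangle of the $k$-th bump. Let $D_{x,u}(h_1,\dots,h_n)$ be the resulting region with the following weights $\mathrm{wt}_2$ of lozenges: a vertical lozenge with center $(i,j)$ has weight $\frac{q^i+q^{-i}}2$ if $i\ne0$ and weight $\frac12$ if $i=0$ (i.e. if the $j$-axis, which passes through the centers of the vertical lozenges in the bumps of the west side, cuts it); all other lozenges have weight $1$. The weight of a lozenge tiling is the product of the weights of its lozenges, and $\mathrm{M}(D_{x,u}(h_1,\dots,h_n))$ is the sum of the weights of all lozenge tilings of the region (equal to $1$ for the empty region). *The product.* For non-negative integers $x,u,d$ and integers $1\le l_1<\dots<l_m\le d$, $1\le h_1<\dots<h_n\le u$ put $e=\min(u-n,d-m)$, $\overline{x}=x+\max(u-n,d-m)$, $t_1=2(x+u-n-e)+1$, $t_2=2(x+d-m-e)$, $f(t,y,z)=\frac{yz(2t+y-z)}2$, $\left\langle{b\atop a}\right\rangle=a+(a+1)+\dots+b$, $$E=f(t_1+2d-m,n,m+1)+\sum_{i=1}^m\left\langle{t_1+2d-m-(m-i+1)\atop t_1+2(d-l_i)-2(m-i)}\right\rangle+\sum_{i=1}^n\left\langle{t_2+2u-n-(n-i+1)\atop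 t_2+2(u-h_i)-2(n-i)}\right\rangle,$$ $$F=n(m+1)+\sum_{i=1}^m(2l_i-i)+\sum_{i=1}^n(2h_i-i),$$ and $$\begin{aligned}P(x,u,d,(l_i)_{i=1}^m,(h_j)_{j=1}^n)=\;&2^{-F}q^{-E}\frac{\prod_{1\le i<j\le m}[2(l_j-l_i)]_{q^2}\prod_{1\le i<j\le n}[2(h_j-h_i)]_{q^2}}{\prod_{i=1}^m\prod_{j=1}^n[2(l_i+h_j)]_{q^2}\prod_{i=1}^m[2l_i-1]_{q^2}!\prod_{j=1}^n[2h_j]_{q^2}!}\\ &\times\prod_{i=1}^{\lceil m/2\rceil}\prod_{j=1}^{2m-4i+3}[2\overline{x}+2i+j-1]_{q^2}\prod_{i=1}^n[2(\overline{x}+m+i)]_{q^2}\prod_{i=1}^n\prod_{j=1}^{m+i}[2\overline{x}+m+i+j]_{q^2}\\ &\times\prod_{i=1}^m\prod_{j=1}^n\frac{[2(\overline{x}+i+j-1)]_{q^2}}{[2(\overline{x}+i+j-1)+1]_{q^2}}\prod_{i=1}^m\prod_{j=1}^{l_i-i}[2(\overline{x}+i+j+n)]_{q^2}[2(\overline{x}-i-j+m+1)]_{q^2}\\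 &\times\prod_{i=1}^n\prod_{j=1}^{h_i-i}[2(\overline{x}+i+j+m)]_{q^2}[2(\overline{x}-i-j+n+1)]_{q^2}.\end{aligned}$$ *Claim.* $$\mathrm{M}(D_{x,u}(h_1,\dots,h_n))=P(x,u,0,\emptyset,(h_j)_{j=1}^n).$$ -/

import Mathlib

open Finset

/-!
# The triangular lattice

Horizontal coordinates `i` are measured in half-edges and heights `j` in half-heights of a
vertical lozenge, so the horizontal lattice lines are the lines of integer height.  The lattice is
placed so that its vertices are the points `(i, j)` with `i + j` odd.

The unit triangle lying between heights `j` and `j + 1` whose horizontal side has midpoint of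
abscissa `a` is named by the pair `(a, j)`; every pair of integers names exactly one triangle, and
the triangles of one row follow each other from left to right as `a` increases.  If `a + j` is
even, the triangle has vertices `(a - 1, j)`, `(a + 1, j)`, `(a, j + 1)` (up-pointing); if `a + j`
is odd, it has vertices `(a - 1, j + 1)`, `(a + 1, j + 1)`, `(a, j)` (down-pointing).
-/

/-- Unit triangles of the triangular lattice. -/
abbrev UnitTriangle : Type := ℤ × ℤ

/-- The up-pointing unit triangles. -/
def UnitTriangle.IsUp (t : UnitTriangle) : Prop := Even (t.1 + t.2)

instance : DecidablePred UnitTriangle.IsUp :=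
  fun t => inferInstanceAs (Decidable (Even (t.1 + t.2)))

/-- Which edge the two unit triangles of a lozenge share: the horizontal side of the up-pointing
triangle (a vertical lozenge), its left side, or its right side. -/
inductive LozengeKind where
  | vertical
  | left
  | right
deriving DecidableEq

instance : Fintype LozengeKind :=
  ⟨{.vertical, .left, .right}, fun x => by cases x <;> simp⟩

/-- A lozenge is given by its up-pointing triangle and by its kind. -/
abbrev Lozenge : Type := UnitTriangle × LozengeKind

/-- The down-pointing triangle of a lozenge. -/
def Lozenge.downTriangle : Lozenge → UnitTriangle
  | ((a, j), .vertical) => (a, j - 1)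
  | ((a, j), .left) => (a - 1, j)
  | ((a, j), .right) => (a + 1, j)

/-- The two unit triangles that make up a lozenge. -/
def Lozenge.cells (L : Lozenge) : Finset UnitTriangle := {L.1, L.downTriangle}

/-- The lozenges contained in a region, i.e. in a finite set of unit triangles. -/
def lozengesIn (R : Finset UnitTriangle) : Finset Lozenge :=
  ((R.filter UnitTriangle.IsUp) ×ˢ (univ : Finset LozengeKind)).filter fun L => L.cells ⊆ R

/-- The lozenge tilings of a region: the sets of lozenges contained in the region such that every
unit triangle of the region belongs to exactly one lozenge of the set. -/
def lozengeTilings (R : Finset UnitTriangle) : Finset (Finset Lozenge) :=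
  (lozengesIn R).powerset.filter fun T => ∀ t ∈ R, #{L ∈ T | t ∈ L.cells} = 1

/-- The tiling generating function `M(R)` of a region with a weight assignment for lozenges. -/
def tilingGF {K : Type*} [Field K] (R : Finset UnitTriangle) (wt : Lozenge → K) : K :=
  ∑ T ∈ lozengeTilings R, ∏ L ∈ T, wt L

/-- The weight assignment `wt₂`.  The vertical lozenge with up-pointing triangle `(a, j)` has
center `(a, j)`, and it is cut by the `j`-axis exactly when `a = 0`. -/
def wt₂ {K : Type*} [Field K] (q : K) : Lozenge → K
  | ((a, _), .vertical) => if a = 0 then 1 / 2 else (q ^ a + q ^ (-a)) / 2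
  | (_, .left) => 1
  | (_, .right) => 1

/-- The halved hexagon with north, northeast, southeast and south sides of lengths
`x`, `2u - n + 1`, `n`, `x + u - n`, with upper left vertex `(0, 2u + 1)`.  Its rows are
`0, …, 2u` from bottom to top.

West side, from top to bottom: `2u` unit steps alternately to the lower left and to the lower
right, between the abscissas `0` and `-1`, followed by one more unit step to the lower right in
row `0` (so the last segment of the zigzag has length `2`).  Hence row `0` starts with the triangle
of abscissa `1`, all others with that of abscissa `0`.

East side, from top to bottom: `2u - n + 1` unit steps to the lower right, from `(2x, 2u + 1)` to
`(2x + 2u - n + 1, n)`, then `n` unit steps to the lower left, to `(2x + 2u - 2n + 1, 0)`.  Hence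
row `j` ends with the triangle of abscissa `2x + 2u - j` if `n ≤ j`, and
`2x + 2u - 2n + 1 + j` if `j < n`; this is the smaller of these two numbers. -/
noncomputable def halvedHexagonB (x u n : ℕ) : Finset UnitTriangle :=
  ((Icc (0 : ℤ) (2 * x + 2 * u)) ×ˢ (Icc (0 : ℤ) (2 * u))).filter fun t =>
    (t.2 = 0 → 1 ≤ t.1) ∧
      t.1 ≤ min (2 * x + 2 * u - t.2 : ℤ) (2 * x + 2 * u - 2 * n + 1 + t.2)

/-- The `k`-th bump on the west side, counted from the bottom (`1 ≤ k ≤ u`), consists of the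
up-pointing triangle `(0, 2k)` and of the down-pointing triangle `(0, 2k - 1)` below it.  The dents
are the up-pointing triangles of the bumps at the positions different from `h₁, …, hₙ`. -/
noncomputable def dents (u : ℕ) {n : ℕ} (h : Fin n → ℕ) : Finset UnitTriangle :=
  ((Icc 1 u).filter fun k => ∀ i, h i ≠ k).image fun k : ℕ => ((0 : ℤ), 2 * (k : ℤ))

/-- The shape of the region `D_{x,u}(h₁, …, hₙ)` (the shape of the regions of type `B`). -/
noncomputable def regionD (x u : ℕ) {n : ℕ} (h : Fin n → ℕ) : Finset UnitTriangle :=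
  halvedHexagonB x u n \ dents u h

/-- The `q`-integer `[n]_r = 1 + r + ⋯ + r ^ (n - 1)`. -/
def qInt {K : Type*} [Field K] (r : K) (n : ℕ) : K := ∑ k ∈ range n, r ^ k

/-- The `q`-factorial `[n]_r! = [1]_r [2]_r ⋯ [n]_r`. -/
def qFact {K : Type*} [Field K] (r : K) (n : ℕ) : K := ∏ k ∈ Icc 1 n, qInt r k

/-- The sum `a + (a + 1) + ⋯ + b`. -/
noncomputable def bracketSum (b a : ℤ) : ℤ := ∑ k ∈ Icc a b, k

/-- `f(t, x, y) = x y (2 t + x - y) / 2`; the division is exact. -/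
def fExp (t x y : ℤ) : ℤ := x * y * (2 * t + x - y) / 2

theorem two_mul_fExp (t x y : ℤ) : 2 * fExp t x y = x * y * (2 * t + x - y) := by
  unfold fExp
  refine Int.mul_ediv_cancel' ?_
  rw [← even_iff_two_dvd]
  simp only [Int.even_mul, Int.even_sub, Int.even_add]
  have h2 : Even (2 : ℤ) := even_two
  tauto

/-- The exponent `E`.  Sequences are indexed from `0` in the code, so `l i` is `l_{i+1}`. -/
noncomputable def expE (x u d : ℕ) {m n : ℕ} (l : Fin m → ℕ) (h : Fin n → ℕ) : ℤ :=
  let e : ℤ := min ((u : ℤ) - n) ((d : ℤ) - m)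
  let t₁ : ℤ := 2 * (x + u - n - e) + 1
  let t₂ : ℤ := 2 * (x + d - m - e)
  fExp (t₁ + 2 * d - m) n (m + 1)
    + ∑ i : Fin m, bracketSum (t₁ + 2 * d - m - (m - ((i : ℤ) + 1) + 1))
        (t₁ + 2 * ((d : ℤ) - l i) - 2 * (m - ((i : ℤ) + 1)))
    + ∑ i : Fin n, bracketSum (t₂ + 2 * u - n - (n - ((i : ℤ) + 1) + 1))
        (t₂ + 2 * ((u : ℤ) - h i) - 2 * (n - ((i : ℤ) + 1)))

/-- The exponent `F = n (m + 1) + ∑ (2 l_i - i) + ∑ (2 h_i - i)`. -/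
def expF {m n : ℕ} (l : Fin m → ℕ) (h : Fin n → ℕ) : ℤ :=
  n * (m + 1) + ∑ i : Fin m, (2 * (l i : ℤ) - ((i : ℤ) + 1))
    + ∑ i : Fin n, (2 * (h i : ℤ) - ((i : ℤ) + 1))

/-- The product `P(x, u, d, (l_i), (h_j))` for strictly increasing sequences of positive integers
`l₁, …, l_m ≤ d` and `h₁, …, h_n ≤ u`.  For such sequences none of the subtractions of natural
numbers below is truncated. -/
noncomputable def prodP {K : Type*} [Field K] (q : K) (x u d : ℕ) {m n : ℕ} (l : Fin m → ℕ) (h : Fin n → ℕ) : K :=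
  let X : ℕ := x + max (u - n) (d - m)
  let I : ℕ → K := qInt (q ^ 2)
  2 ^ (-expF l h) * q ^ (-expE x u d l h)
    * ((∏ i : Fin m, ∏ j ∈ Ioi i, I (2 * (l j - l i)))
        * (∏ i : Fin n, ∏ j ∈ Ioi i, I (2 * (h j - h i)))
      / ((∏ i : Fin m, ∏ j : Fin n, I (2 * (l i + h j)))
        * (∏ i : Fin m, qFact (q ^ 2) (2 * l i - 1))
        * (∏ j : Fin n, qFact (q ^ 2) (2 * h j))))
    * (∏ i ∈ Icc 1 ((m + 1) / 2), ∏ j ∈ Icc 1 (2 * m + 3 - 4 * i), I (2 * X + 2 * i + j - 1))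
    * (∏ i ∈ Icc 1 n, I (2 * (X + m + i)))
    * (∏ i ∈ Icc 1 n, ∏ j ∈ Icc 1 (m + i), I (2 * X + m + i + j))
    * (∏ i ∈ Icc 1 m, ∏ j ∈ Icc 1 n, I (2 * (X + i + j - 1)) / I (2 * (X + i + j - 1) + 1))
    * (∏ i : Fin m, ∏ j ∈ Icc 1 (l i - ((i : ℕ) + 1)),
        I (2 * (X + (i + 1) + j + n)) * I (2 * (X + m + 1 - (i + 1) - j)))
    * (∏ i : Fin n, ∏ j ∈ Icc 1 (h i - ((i : ℕ) + 1)),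
        I (2 * (X + (i + 1) + j + m)) * I (2 * (X + n + 1 - (i + 1) - j)))

/-!
A lozenge tiling is a family of non-intersecting lattice paths, the `i`-th of which arrives at the
`j`-axis at height `2 * h i`. Forced vertical lozenges enlarge the region to a trapezoid in which
all paths start in the lowest row. This trapezoid can be emptied by removing one triangle or one
lozenge at a time, and both the weighted count of the tilings and the determinant of the path
generating functions obey the same recursion under this removal, so they agree.

Summed over all paths to the axis, the weight factors into symmetric `q`-integers. After common
factors are taken out of its rows and columns, the entry `(k, i)` of the determinant is a product of
`n - 1` linear forms, depending only on `k`, evaluated at `([2 hᵢ], q ^ (2 hᵢ))`. Such a determinant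
is a constant times a homogeneous Vandermonde determinant, and the constant is read off at zeros of
the forms, where the matrix becomes triangular.
-/

section Tilings

theorem mem_lozengesIn {R : Finset UnitTriangle} {L : Lozenge} :
    L ∈ lozengesIn R ↔ L.1.IsUp ∧ L.cells ⊆ R := by
  simp only [lozengesIn, mem_filter, mem_product, mem_univ, and_true, and_congr_left_iff,
    and_iff_right_iff_imp]
  exact fun hcells _ ↦ hcells (mem_insert_self _ _)

theorem fst_mem_cells (L : Lozenge) : L.1 ∈ L.cells := mem_insert_self _ _

theorem mem_lozengeTilings {R : Finset UnitTriangle} {T : Finset Lozenge} :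
    T ∈ lozengeTilings R ↔ T ⊆ lozengesIn R ∧ ∀ t ∈ R, ∃! L, L ∈ T ∧ t ∈ L.cells := by
  simp only [lozengeTilings, mem_filter, mem_powerset, card_eq_one_iff_existsUnique]

theorem cells_subset_of_mem_lozengeTilings {R : Finset UnitTriangle} {T : Finset Lozenge}
    (hT : T ∈ lozengeTilings R) {L : Lozenge} (hL : L ∈ T) : L.cells ⊆ R :=
  (mem_lozengesIn.1 ((mem_lozengeTilings.1 hT).1 hL)).2

theorem eq_of_mem_cells_of_mem_lozengeTilings {R : Finset UnitTriangle} {T : Finset Lozenge}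
    (hT : T ∈ lozengeTilings R) {L L' : Lozenge} (hL : L ∈ T) (hL' : L' ∈ T) {t : UnitTriangle}
    (ht : t ∈ L.cells) (ht' : t ∈ L'.cells) : L = L' :=
  ((mem_lozengeTilings.1 hT).2 t (cells_subset_of_mem_lozengeTilings hT hL ht)).unique
    ⟨hL, ht⟩ ⟨hL', ht'⟩

theorem erase_mem_lozengeTilings {R : Finset UnitTriangle} {T : Finset Lozenge}
    (hT : T ∈ lozengeTilings R) {L : Lozenge} (hL : L ∈ T) :
    T.erase L ∈ lozengeTilings (R \ L.cells) := by
  refine mem_lozengeTilings.2 ⟨fun L' hL' ↦ ?_, fun t ht ↦ ?_⟩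
  · obtain ⟨hne, hL'T⟩ := mem_erase.1 hL'
    refine mem_lozengesIn.2 ⟨(mem_lozengesIn.1 ((mem_lozengeTilings.1 hT).1 hL'T)).1,
      fun t ht ↦ mem_sdiff.2 ⟨cells_subset_of_mem_lozengeTilings hT hL'T ht, fun htL ↦ hne ?_⟩⟩
    exact eq_of_mem_cells_of_mem_lozengeTilings hT hL'T hL ht htL
  · obtain ⟨htR, htL⟩ := mem_sdiff.1 ht
    obtain ⟨L', ⟨hL'T, htL'⟩, huniq⟩ := (mem_lozengeTilings.1 hT).2 t htR
    have hne : L' ≠ L := fun h ↦ htL (h ▸ htL')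
    exact ⟨L', ⟨mem_erase.2 ⟨hne, hL'T⟩, htL'⟩, fun M hM ↦ huniq M ⟨mem_of_mem_erase hM.1, hM.2⟩⟩

theorem notMem_of_mem_lozengeTilings_sdiff {R : Finset UnitTriangle} {T : Finset Lozenge}
    {L : Lozenge} (hT : T ∈ lozengeTilings (R \ L.cells)) : L ∉ T := fun hL ↦
  (mem_sdiff.1 (cells_subset_of_mem_lozengeTilings hT hL (fst_mem_cells L))).2 (fst_mem_cells L)

theorem insert_mem_lozengeTilings {R : Finset UnitTriangle} {T : Finset Lozenge} {L : Lozenge}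
    (hL : L ∈ lozengesIn R) (hT : T ∈ lozengeTilings (R \ L.cells)) :
    insert L T ∈ lozengeTilings R := by
  have hsub {M : Lozenge} (hM : M ∈ T) : M.cells ⊆ R \ L.cells :=
    cells_subset_of_mem_lozengeTilings hT hM
  refine mem_lozengeTilings.2 ⟨insert_subset hL fun M hM ↦ mem_lozengesIn.2
    ⟨(mem_lozengesIn.1 ((mem_lozengeTilings.1 hT).1 hM)).1, (hsub hM).trans sdiff_subset⟩,
    fun t ht ↦ ?_⟩
  by_cases htL : t ∈ L.cells
  · refine ⟨L, ⟨mem_insert_self _ _, htL⟩, fun M ⟨hM, htM⟩ ↦ ?_⟩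
    exact (mem_insert.1 hM).resolve_right fun hMT ↦ (mem_sdiff.1 (hsub hMT htM)).2 htL
  · obtain ⟨M, ⟨hMT, htM⟩, huniq⟩ := (mem_lozengeTilings.1 hT).2 t (mem_sdiff.2 ⟨ht, htL⟩)
    refine ⟨M, ⟨mem_insert_of_mem hMT, htM⟩, fun M' ⟨hM', htM'⟩ ↦ huniq M' ⟨?_, htM'⟩⟩
    exact (mem_insert.1 hM').resolve_left fun h ↦ htL (h ▸ htM')

theorem lozengeTilings_empty : lozengeTilings ∅ = {∅} := by
  ext T
  rw [mem_lozengeTilings, mem_singleton]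
  refine ⟨fun ⟨hT, _⟩ ↦ eq_empty_of_forall_notMem fun L hL ↦ ?_, fun h ↦ by simp [h]⟩
  exact notMem_empty _ ((mem_lozengesIn.1 (hT hL)).2 (fst_mem_cells L))

variable {K : Type*} [Field K] (wt : Lozenge → K) {R : Finset UnitTriangle}

theorem tilingGF_empty : tilingGF ∅ wt = 1 := by
  rw [tilingGF, lozengeTilings_empty, sum_singleton, prod_empty]

theorem sum_prod_filter_mem_lozengeTilings {L : Lozenge} (hL : L ∈ lozengesIn R) :
    ∑ T ∈ lozengeTilings R with L ∈ T, ∏ M ∈ T, wt M = wt L * tilingGF (R \ L.cells) wt := by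
  rw [tilingGF, mul_sum]
  refine sum_bij' (fun T _ ↦ T.erase L) (fun T _ ↦ insert L T) ?_ ?_ ?_ ?_ ?_
  · exact fun T hT ↦ erase_mem_lozengeTilings (mem_filter.1 hT).1 (mem_filter.1 hT).2
  · exact fun T hT ↦ mem_filter.2 ⟨insert_mem_lozengeTilings hL hT, mem_insert_self _ _⟩
  · exact fun T hT ↦ insert_erase (mem_filter.1 hT).2
  · exact fun T hT ↦ erase_insert (notMem_of_mem_lozengeTilings_sdiff hT)
  · exact fun T hT ↦ (mul_prod_erase T wt (mem_filter.1 hT).2).symm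

theorem tilingGF_eq_sum_covering {t : UnitTriangle} (ht : t ∈ R) :
    tilingGF R wt = ∑ L ∈ lozengesIn R with t ∈ L.cells, wt L * tilingGF (R \ L.cells) wt := by
  have hcover : ∀ T ∈ lozengeTilings R, ∏ M ∈ T, wt M =
      ∑ L ∈ lozengesIn R with t ∈ L.cells, if L ∈ T then ∏ M ∈ T, wt M else 0 := by
    intro T hT
    obtain ⟨L, ⟨hLT, htL⟩, huniq⟩ := (mem_lozengeTilings.1 hT).2 t ht
    rw [sum_eq_single_of_mem L, if_pos hLT]
    · exact mem_filter.2 ⟨(mem_lozengeTilings.1 hT).1 hLT, htL⟩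
    · exact fun M hM hne ↦ if_neg fun hMT ↦ hne (huniq M ⟨hMT, (mem_filter.1 hM).2⟩)
  rw [tilingGF, sum_congr rfl hcover, sum_comm]
  refine sum_congr rfl fun L hL ↦ ?_
  rw [← sum_filter, sum_prod_filter_mem_lozengeTilings wt (mem_filter.1 hL).1]

theorem tilingGF_eq_sum_kind {t : UnitTriangle} (ht : t ∈ R) {g : LozengeKind → Lozenge}
    (hinj : g.Injective) (hg : ∀ L : Lozenge, L.1.IsUp ∧ t ∈ L.cells ↔ ∃ k, g k = L) :
    tilingGF R wt =
      ∑ k, if (g k).cells ⊆ R then wt (g k) * tilingGF (R \ (g k).cells) wt else 0 := by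
  have himage : {L ∈ lozengesIn R | t ∈ L.cells} =
      ({k | (g k).cells ⊆ R} : Finset LozengeKind).image g := by
    ext L
    simp only [mem_filter, mem_lozengesIn, mem_image, mem_univ, true_and]
    refine ⟨fun ⟨⟨hup, hsub⟩, htL⟩ ↦ ?_, ?_⟩
    · obtain ⟨k, rfl⟩ := (hg L).1 ⟨hup, htL⟩
      exact ⟨k, hsub, rfl⟩
    · rintro ⟨k, hsub, rfl⟩
      have hk := (hg (g k)).2 ⟨k, rfl⟩
      exact ⟨⟨hk.1, hsub⟩, hk.2⟩
  rw [tilingGF_eq_sum_covering wt ht, himage, sum_image hinj.injOn, sum_filter]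

theorem sum_lozengeKind {M : Type*} [AddCommMonoid M] (f : LozengeKind → M) :
    ∑ k, f k = f .vertical + (f .left + f .right) := by
  rw [show (univ : Finset LozengeKind) = {.vertical, .left, .right} from rfl,
    sum_insert (by decide), sum_insert (by decide), sum_singleton]

theorem exists_lozengeKind {p : LozengeKind → Prop} :
    (∃ k, p k) ↔ p .vertical ∨ p .left ∨ p .right :=
  ⟨fun ⟨k, hk⟩ ↦ by cases k <;> simp only [hk, true_or, or_true],
    fun h ↦ h.elim (⟨.vertical, ·⟩) (·.elim (⟨.left, ·⟩) (⟨.right, ·⟩))⟩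

theorem tilingGF_of_isUp {t : UnitTriangle} (hup : t.IsUp) (ht : t ∈ R)
    (hbelow : (t.1, t.2 - 1) ∉ R) (hright : (t.1 + 1, t.2) ∉ R) :
    tilingGF R wt =
      if (t.1 - 1, t.2) ∈ R then wt (t, .left) * tilingGF (R \ {t, (t.1 - 1, t.2)}) wt else 0 := by
  obtain ⟨a, j⟩ := t
  have hg (L : Lozenge) : L.1.IsUp ∧ (a, j) ∈ L.cells ↔ ∃ k, ((a, j), k) = L := by
    obtain ⟨⟨b, i⟩, k⟩ := L
    simp only [UnitTriangle.IsUp, Int.even_iff] at hup ⊢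
    cases k <;> simp only [Lozenge.cells, Lozenge.downTriangle, mem_insert, mem_singleton,
      Prod.mk.injEq, exists_eq_right] <;> grind
  rw [tilingGF_eq_sum_kind wt ht (fun _ _ h ↦ (Prod.mk.inj h).2) hg, sum_lozengeKind]
  simp [Lozenge.cells, Lozenge.downTriangle, insert_subset_iff, ht, hbelow, hright]

theorem tilingGF_of_not_isUp {t : UnitTriangle} (hdown : ¬ t.IsUp) (ht : t ∈ R)
    (hright : (t.1 + 1, t.2) ∉ R) :
    tilingGF R wt =
      (if (t.1, t.2 + 1) ∈ R then
        wt ((t.1, t.2 + 1), .vertical) * tilingGF (R \ {t, (t.1, t.2 + 1)}) wt else 0) +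
      if (t.1 - 1, t.2) ∈ R then
        wt ((t.1 - 1, t.2), .right) * tilingGF (R \ {t, (t.1 - 1, t.2)}) wt else 0 := by
  obtain ⟨a, j⟩ := t
  let g : LozengeKind → Lozenge
    | .vertical => ((a, j + 1), .vertical)
    | .left => ((a + 1, j), .left)
    | .right => ((a - 1, j), .right)
  have hinj : g.Injective := by rintro (_ | _ | _) (_ | _ | _) <;> simp [g]
  have hg (L : Lozenge) : L.1.IsUp ∧ (a, j) ∈ L.cells ↔ ∃ k, g k = L := by
    rw [exists_lozengeKind]
    obtain ⟨⟨b, i⟩, k⟩ := L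
    simp only [UnitTriangle.IsUp, Int.even_iff] at hdown ⊢
    cases k <;> simp only [g, Lozenge.cells, Lozenge.downTriangle, mem_insert, mem_singleton,
      Prod.mk.injEq, reduceCtorEq, and_true, and_false, or_false, false_or] <;> lia
  rw [tilingGF_eq_sum_kind wt ht hinj hg, sum_lozengeKind]
  simp [g, Lozenge.cells, Lozenge.downTriangle, insert_subset_iff, ht, hright, pair_comm (a, j)]

/-- A set of down-pointing triangles of `R` each of which has to be covered by a vertical lozenge:
its neighbour above lies in `R`, its left and right neighbours do not. -/
def ForcesVertical (R D : Finset UnitTriangle) : Prop :=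
  ∀ t ∈ D, ¬ t.IsUp ∧ t ∈ R ∧ (t.1, t.2 + 1) ∈ R ∧ (t.1 - 1, t.2) ∉ R ∧ (t.1 + 1, t.2) ∉ R

theorem ForcesVertical.of_insert {D : Finset UnitTriangle} {t : UnitTriangle}
    (h : ForcesVertical R (insert t D)) (ht : t ∉ D) :
    ForcesVertical (R \ {t, (t.1, t.2 + 1)}) D := by
  intro s hs
  obtain ⟨hsdown, hsR, hsabove, hsleft, hsright⟩ := h s (mem_insert_of_mem hs)
  have htdown := (h t (mem_insert_self _ _)).1
  have hne : s ≠ t := ne_of_mem_of_not_mem hs ht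
  obtain ⟨a, i⟩ := s
  obtain ⟨b, j⟩ := t
  simp only [UnitTriangle.IsUp, Int.even_iff, ne_eq, Prod.mk.injEq] at hsdown htdown hne
  simp only [UnitTriangle.IsUp, Int.even_iff, mem_sdiff, mem_insert, mem_singleton,
    Prod.mk.injEq, hsR, hsabove, hsleft, hsright]
  lia

theorem ForcesVertical.tilingGF_eq {D : Finset UnitTriangle} (h : ForcesVertical R D) :
    tilingGF R wt = (∏ t ∈ D, wt ((t.1, t.2 + 1), .vertical)) *
      tilingGF (R \ (D ∪ D.image fun t ↦ (t.1, t.2 + 1))) wt := by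
  induction D using Finset.induction_on generalizing R with
  | empty => simp
  | insert t D htD ih =>
    obtain ⟨hdown, htR, habove, hleft, hright⟩ := h t (mem_insert_self _ _)
    rw [tilingGF_of_not_isUp wt hdown htR hright, if_pos habove, if_neg hleft, add_zero,
      ih (h.of_insert htD), prod_insert htD, mul_assoc, sdiff_sdiff_left]
    congr 3
    ext s
    simp only [sup_eq_union, mem_union, mem_insert, mem_singleton, mem_sdiff, image_insert]
    tauto

end Tilings

section PathGF

variable {K : Type*}

/-- `F (a, j)` is the generating function of the lattice paths from the up-pointing triangle
`(a, j)` to the `j`-axis at height `e`. A path goes from the up-pointing triangle `(a, j)` through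
the down-pointing triangle `(a - 1, j)` to the up-pointing triangle above it or to its left, and
it has the weight of the lozenges formed by its down-pointing triangles and their successors. -/
structure IsPathGF [Field K] (wt : Lozenge → K) (e : ℤ) (F : UnitTriangle → K) : Prop where
  step : ∀ a j : ℤ, 1 ≤ a → Even (a + j) → F (a, j) =
    wt ((a - 1, j + 1), .vertical) * F (a - 1, j + 1) + wt ((a - 2, j), .right) * F (a - 2, j)
  eq_zero_of_neg : ∀ a j : ℤ, a < 0 → F (a, j) = 0
  eq_zero_of_lt : ∀ a j : ℤ, e < j → F (a, j) = 0
  axis : ∀ j : ℤ, F (0, j) = if j = e then 1 else 0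

/-- The Lindström–Gessel–Viennot matrix of path generating functions, with rows indexed by the
starting triangles `p k` and columns by the end points. -/
def pathMatrix {n : ℕ} (F : Fin n → UnitTriangle → K) (p : Fin n → UnitTriangle) :
    Matrix (Fin n) (Fin n) K :=
  Matrix.of fun k i ↦ F i (p k)

variable {n : ℕ} {F : Fin n → UnitTriangle → K} {p : Fin n → UnitTriangle}

theorem pathMatrix_update (k : Fin n) (v : UnitTriangle) :
    pathMatrix F (Function.update p k v) = (pathMatrix F p).updateRow k fun i ↦ F i v := by
  ext l i
  obtain rfl | hne := eq_or_ne l k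
  · simp [pathMatrix]
  · simp [pathMatrix, hne]

variable [Field K]

theorem det_pathMatrix_eq_zero_of_column (i : Fin n) (hi : ∀ k, F i (p k) = 0) :
    (pathMatrix F p).det = 0 :=
  Matrix.det_eq_zero_of_column_eq_zero i hi

theorem det_pathMatrix_update_eq_zero {k : Fin n} {v : UnitTriangle} (hv : ∀ i, F i v = 0) :
    (pathMatrix F (Function.update p k v)).det = 0 := by
  rw [pathMatrix_update]
  exact Matrix.det_eq_zero_of_row_eq_zero k (by simpa using hv)

theorem det_pathMatrix_update_eq_zero_of_eq {k l : Fin n} (hkl : l ≠ k) :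
    (pathMatrix F (Function.update p k (p l))).det = 0 :=
  Matrix.det_zero_of_row_eq hkl.symm (funext fun i ↦ by simp [pathMatrix, hkl])

theorem det_pathMatrix_step {wt : Lozenge → K} {e : Fin n → ℤ} (hF : ∀ i, IsPathGF wt (e i) (F i))
    {k : Fin n} {a j : ℤ} (hk : p k = (a, j)) (ha : 1 ≤ a) (haj : Even (a + j)) :
    (pathMatrix F p).det =
      wt ((a - 1, j + 1), .vertical) *
        (pathMatrix F (Function.update p k (a - 1, j + 1))).det +
      wt ((a - 2, j), .right) * (pathMatrix F (Function.update p k (a - 2, j))).det := by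
  have hrow : pathMatrix F p = (pathMatrix F p).updateRow k
      ((wt ((a - 1, j + 1), .vertical) • fun i ↦ F i (a - 1, j + 1)) +
        wt ((a - 2, j), .right) • fun i ↦ F i (a - 2, j)) := by
    conv_lhs => rw [← Function.update_eq_self k p, pathMatrix_update, hk]
    congr 1
    exact funext fun i ↦ (hF i).step a j ha haj
  rw [hrow, Matrix.det_updateRow_add, Matrix.det_updateRow_smul, Matrix.det_updateRow_smul,
    pathMatrix_update, pathMatrix_update]

end PathGF

section Trapezoid

/-- The halved hexagon with the dents of `D_{x,u}(h₁, …, hₙ)`, enlarged to the right so that its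
east side is a single lattice line going from the north side down to the line `j = 0`. -/
noncomputable def dentedTrapezoid (x u : ℕ) {n : ℕ} (h : Fin n → ℕ) : Finset UnitTriangle :=
  halvedHexagonB x u 0 \ dents u h

variable {x u n : ℕ} {h : Fin n → ℕ}

theorem mem_dents {a j : ℤ} :
    (a, j) ∈ dents u h ↔ a = 0 ∧ 1 ≤ j ∧ j ≤ 2 * u ∧ Even j ∧ ∀ i, j ≠ 2 * h i := by
  simp only [dents, mem_image, mem_filter, mem_Icc, Prod.mk.injEq]
  constructor
  · rintro ⟨k, ⟨hk, hne⟩, rfl, rfl⟩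
    refine ⟨rfl, by lia, by lia, even_two_mul _, fun i hi ↦ hne i (by lia)⟩
  · rintro ⟨rfl, hpos, hle, ⟨k, hk⟩, hne⟩
    exact ⟨k.toNat, ⟨by lia, fun i hi ↦ hne i (by lia)⟩, rfl, by lia⟩

theorem mem_dentedTrapezoid {a j : ℤ} :
    (a, j) ∈ dentedTrapezoid x u h ↔ 0 ≤ a ∧ 0 ≤ j ∧ j ≤ 2 * u ∧ a + j ≤ 2 * x + 2 * u ∧
      (j = 0 → 1 ≤ a) ∧ (a = 0 → Even j → ∃ i, j = 2 * h i) := by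
  have hdent : (∃ i, j = 2 * h i) ↔ ¬ ∀ i, j ≠ 2 * h i := by simp
  rw [hdent, dentedTrapezoid, mem_sdiff, mem_dents]
  simp only [halvedHexagonB, mem_filter, mem_product, mem_Icc]
  grind

end Trapezoid

section PathStates

variable {n : ℕ} {R : Finset UnitTriangle} {p : Fin n → UnitTriangle} {j b : ℤ}

/-- What is left of `R` once the rows below `j` and the triangles of row `j` to the right of
abscissa `b` have been covered and the paths have been followed up to the triangles `p k`. -/
def remainingRegion (R : Finset UnitTriangle) (p : Fin n → UnitTriangle) (j b : ℤ) :
    Finset UnitTriangle :=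
  {t ∈ R | (j < t.2 ∨ t.2 = j ∧ t.1 ≤ b) ∧ ∀ k, p k ≠ t}

/-- The possible positions `p` of the paths once the rows below `j` and the triangles of row `j`
to the right of abscissa `b` have been covered. The paths do not cross, so their heads are ordered
by row and, within a row, by abscissa. -/
structure IsPathState (R : Finset UnitTriangle) (p : Fin n → UnitTriangle) (j b : ℤ) :
    Prop where
  sorted : ∀ k l, k < l → (p k).2 < (p l).2 ∨ (p k).2 = (p l).2 ∧ (p k).1 < (p l).1
  mem : ∀ k, p k ∈ R
  isUp : ∀ k, (p k).IsUp
  location : ∀ k, (p k).2 < j ∧ (p k).1 = 0 ∨ (p k).2 = j ∧ (p k).1 ≤ b ∨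
    (p k).2 = j + 1 ∧ b < (p k).1

theorem mem_remainingRegion {t : UnitTriangle} :
    t ∈ remainingRegion R p j b ↔ t ∈ R ∧ (j < t.2 ∨ t.2 = j ∧ t.1 ≤ b) ∧ ∀ k, p k ≠ t := by
  simp only [remainingRegion, mem_filter]

theorem IsPathState.injective (hp : IsPathState R p j b) : p.Injective := by
  intro k l hkl
  have hlt := hp.sorted k l
  have hgt := hp.sorted l k
  rw [hkl] at hlt hgt
  lia

theorem IsPathState.skip (hp : IsPathState R p j b) (hb : Even (b + j))
    (hfree : ∀ k, p k ≠ (b, j)) : IsPathState R p j (b - 2) := by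
  refine ⟨hp.sorted, hp.mem, hp.isUp, fun k ↦ ?_⟩
  have hloc := hp.location k
  have hup := hp.isUp k
  have hne := hfree k
  simp only [UnitTriangle.IsUp, Int.even_iff, ne_eq, Prod.ext_iff] at hup hb hne
  lia

theorem IsPathState.update (hp : IsPathState R p j b) {i : Fin n} (hi : p i = (b, j))
    {v : UnitTriangle} (hv : v = (b - 1, j + 1) ∨ v = (b - 2, j)) (hvR : v ∈ R)
    (hfree : ∀ k, p k ≠ v) : IsPathState R (Function.update p i v) j (b - 2) := by
  have hup_i := hp.isUp i
  rw [hi] at hup_i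
  simp only [UnitTriangle.IsUp, Int.even_iff] at hup_i
  have hother : ∀ k, k ≠ i → (p k).2 < j ∧ (p k).1 = 0 ∨
      (p k).2 = j ∧ (p k).1 ≤ b - 2 ∨ (p k).2 = j + 1 ∧ b < (p k).1 := by
    intro k hk
    have hloc := hp.location k
    have hup := hp.isUp k
    have hne := hp.injective.ne hk
    simp only [hi, UnitTriangle.IsUp, Int.even_iff, ne_eq, Prod.ext_iff] at hup hne
    lia
  have hcoord : v.1 = b - 1 ∧ v.2 = j + 1 ∨ v.1 = b - 2 ∧ v.2 = j := by
    rcases hv with rfl | rfl <;> simp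
  refine ⟨fun k l hkl ↦ ?_, fun k ↦ ?_, fun k ↦ ?_, fun k ↦ ?_⟩
  · have hsorted := hp.sorted k l hkl
    have hfree_k := hfree k
    have hfree_l := hfree l
    rw [ne_eq, Prod.ext_iff] at hfree_k hfree_l
    obtain rfl | hk := eq_or_ne k i
    · have := hother l hkl.ne'
      simp only [Function.update_self, Function.update_of_ne hkl.ne']
      lia
    obtain rfl | hl := eq_or_ne l i
    · have := hother k hk
      simp only [Function.update_self, Function.update_of_ne hk]
      lia
    · simpa only [Function.update_of_ne hk, Function.update_of_ne hl] using hsorted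
  · obtain rfl | hk := eq_or_ne k i <;> simp [*, hp.mem]
  · obtain rfl | hk := eq_or_ne k i
    · simp only [Function.update_self, UnitTriangle.IsUp, Int.even_iff]
      lia
    · simpa only [Function.update_of_ne hk] using hp.isUp k
  · obtain rfl | hk := eq_or_ne k i
    · simp only [Function.update_self]
      lia
    · have := hother k hk
      simp only [Function.update_of_ne hk]
      lia

theorem IsPathState.next_row (hp : IsPathState R p j b) (hb : b ≤ 0) {B : ℤ}
    (hR : ∀ t ∈ R, 0 ≤ t.1 ∧ (t.2 = j + 1 → t.1 ≤ B)) : IsPathState R p (j + 1) B := by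
  refine ⟨hp.sorted, hp.mem, hp.isUp, fun k ↦ ?_⟩
  have hloc := hp.location k
  have hk := hR _ (hp.mem k)
  lia

theorem remainingRegion_skip :
    remainingRegion R p j (b - 2) = remainingRegion R p j b \ {(b, j), (b - 1, j)} := by
  ext t
  simp only [mem_remainingRegion, mem_sdiff, mem_insert, mem_singleton, not_or, Prod.ext_iff]
  grind

theorem remainingRegion_update {i : Fin n} (hi : p i = (b, j)) (v : UnitTriangle) :
    remainingRegion R (Function.update p i v) j (b - 2) =
      remainingRegion R p j b \ {(b - 1, j), v} := by
  ext t
  have hforall : (∀ k, p k ≠ t) ↔ (b, j) ≠ t ∧ ∀ k, k ≠ i → p k ≠ t := by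
    rw [← hi]
    grind
  have hforall_update :
      (∀ k, Function.update p i v k ≠ t) ↔ v ≠ t ∧ ∀ k, k ≠ i → p k ≠ t := by
    simp only [Function.update_apply]
    grind
  simp only [mem_remainingRegion, mem_sdiff, mem_insert, mem_singleton, not_or, hforall,
    hforall_update, Prod.ext_iff]
  grind

theorem remainingRegion_next_row {B : ℤ} (hR : ∀ t ∈ R, t.2 = j + 1 → t.1 ≤ B)
    (hrow : ∀ t ∈ R, t.2 = j → t.1 ≤ b → ∃ k, p k = t) :
    remainingRegion R p (j + 1) B = remainingRegion R p j b := by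
  ext t
  simp only [mem_remainingRegion]
  grind

end PathStates

section DeterminantFormula

variable {K : Type*} [Field K] {wt : Lozenge → K} {x u n : ℕ} {h : Fin n → ℕ}
  {F : Fin n → UnitTriangle → K} {p : Fin n → UnitTriangle} {j b : ℤ}

/-- The determinant formula for the tilings of `R` at the stage `(j, b)` of the covering of `R`
by rows, from bottom to top and from right to left. -/
def DetFormulaAt (wt : Lozenge → K) (R : Finset UnitTriangle) (F : Fin n → UnitTriangle → K)
    (j b : ℤ) : Prop :=
  ∀ p, IsPathState R p j b → tilingGF (remainingRegion R p j b) wt = (pathMatrix F p).det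

theorem IsPathGF.eq_zero_of_notMem (hF : ∀ i, IsPathGF wt (2 * h i) (F i))
    (hpos : ∀ i, 1 ≤ h i) (hle : ∀ i, h i ≤ u) {v : UnitTriangle} (hrow : 0 ≤ v.2)
    (hright : v.1 + v.2 ≤ 2 * x + 2 * u) (hv : v ∉ dentedTrapezoid x u h) (i : Fin n) :
    F i v = 0 := by
  obtain ⟨a, r⟩ := v
  obtain hneg | hnonneg := lt_or_ge a 0
  · exact (hF i).eq_zero_of_neg a r hneg
  obtain htop | hinside := lt_or_ge (2 * h i : ℤ) r
  · exact (hF i).eq_zero_of_lt a r htop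
  have hi_pos := hpos i
  have hi_le := hle i
  rw [mem_dentedTrapezoid] at hv
  obtain rfl : a = 0 := by grind
  rw [(hF i).axis, if_neg (by grind)]

/-- The two ways to continue a path at `(b, j)` correspond to the two ways to cover the
down-pointing triangle to its left. If the next triangle `v` is not free, then both sides vanish,
the right one because of a zero row or of two equal rows. -/
theorem DetFormulaAt.branch (hdet : DetFormulaAt wt (dentedTrapezoid x u h) F j (b - 2))
    (hF : ∀ i, IsPathGF wt (2 * h i) (F i)) (hpos : ∀ i, 1 ≤ h i) (hle : ∀ i, h i ≤ u)
    (hp : IsPathState (dentedTrapezoid x u h) p j b) {i : Fin n} (hi : p i = (b, j))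
    {v : UnitTriangle} (hv : v = (b - 1, j + 1) ∨ v = (b - 2, j)) :
    (if v ∈ remainingRegion (dentedTrapezoid x u h) p j b then
      tilingGF (remainingRegion (dentedTrapezoid x u h) p j b \ {(b - 1, j), v}) wt else 0) =
      (pathMatrix F (Function.update p i v)).det := by
  by_cases hvR : v ∈ dentedTrapezoid x u h
  · by_cases hfree : ∀ k, p k ≠ v
    · have hvmem : v ∈ remainingRegion (dentedTrapezoid x u h) p j b :=
        mem_remainingRegion.2 ⟨hvR, by grind, hfree⟩
      rw [if_pos hvmem, ← remainingRegion_update hi, hdet _ (hp.update hi hv hvR hfree)]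
    · push Not at hfree
      obtain ⟨l, rfl⟩ := hfree
      have hli : l ≠ i := by grind
      rw [det_pathMatrix_update_eq_zero_of_eq hli, if_neg]
      exact fun hmem ↦ (mem_remainingRegion.1 hmem).2.2 l rfl
  · have hmem := hi ▸ hp.mem i
    rw [mem_dentedTrapezoid] at hmem
    rw [if_neg fun hmem ↦ hvR (mem_remainingRegion.1 hmem).1, det_pathMatrix_update_eq_zero]
    exact IsPathGF.eq_zero_of_notMem hF hpos hle (by grind) (by grind) hvR

theorem DetFormulaAt.of_occupied (hdet : DetFormulaAt wt (dentedTrapezoid x u h) F j (b - 2))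
    (hF : ∀ i, IsPathGF wt (2 * h i) (F i)) (hpos : ∀ i, 1 ≤ h i) (hle : ∀ i, h i ≤ u)
    (hb : 1 ≤ b) (hbj : Even (b + j)) (hp : IsPathState (dentedTrapezoid x u h) p j b)
    {i : Fin n} (hi : p i = (b, j)) :
    tilingGF (remainingRegion (dentedTrapezoid x u h) p j b) wt = (pathMatrix F p).det := by
  have hiR : (b, j) ∈ dentedTrapezoid x u h := hi ▸ hp.mem i
  have hdown : ¬ UnitTriangle.IsUp (b - 1, j) := by
    simp only [UnitTriangle.IsUp, Int.even_iff] at hbj ⊢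
    lia
  have hmem : (b - 1, j) ∈ remainingRegion (dentedTrapezoid x u h) p j b := by
    have hne : ∀ k, p k ≠ (b - 1, j) := fun k hk ↦ hdown (hk ▸ hp.isUp k)
    rw [mem_dentedTrapezoid] at hiR
    rw [mem_remainingRegion, mem_dentedTrapezoid]
    grind
  have hright : (b - 1 + 1, j) ∉ remainingRegion (dentedTrapezoid x u h) p j b := fun hmem ↦
    (mem_remainingRegion.1 hmem).2.2 i (by simp [hi])
  rw [tilingGF_of_not_isUp wt hdown hmem hright, det_pathMatrix_step hF hi hb hbj,
    ← hdet.branch hF hpos hle hp hi (.inl rfl), ← hdet.branch hF hpos hle hp hi (.inr rfl)]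
  simp only [show b - 1 - 1 = b - 2 by ring, mul_ite, mul_zero]

theorem DetFormulaAt.of_unoccupied (hdet : DetFormulaAt wt (dentedTrapezoid x u h) F j (b - 2))
    (hwt : ∀ t, wt (t, .left) = 1) (hb : 1 ≤ b) (hbj : Even (b + j))
    (hp : IsPathState (dentedTrapezoid x u h) p j b) (hfree : ∀ k, p k ≠ (b, j)) :
    tilingGF (remainingRegion (dentedTrapezoid x u h) p j b) wt = (pathMatrix F p).det := by
  have hmem_iff : (b - 1, j) ∈ remainingRegion (dentedTrapezoid x u h) p j b ↔
      (b, j) ∈ remainingRegion (dentedTrapezoid x u h) p j b := by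
    have hne : ∀ k, p k ≠ (b - 1, j) := by
      intro k hk
      have hup := hp.isUp k
      simp only [hk, UnitTriangle.IsUp, Int.even_iff] at hup hbj
      lia
    simp only [mem_remainingRegion, mem_dentedTrapezoid]
    grind
  rw [← hdet p (hp.skip hbj hfree), remainingRegion_skip]
  by_cases hmem : (b, j) ∈ remainingRegion (dentedTrapezoid x u h) p j b
  · have hbelow : (b, j - 1) ∉ remainingRegion (dentedTrapezoid x u h) p j b := by
      simp [mem_remainingRegion]
    have hright : (b + 1, j) ∉ remainingRegion (dentedTrapezoid x u h) p j b := by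
      simp [mem_remainingRegion]
    rw [tilingGF_of_isUp (t := (b, j)) wt hbj hmem hbelow hright, if_pos (hmem_iff.2 hmem), hwt,
      one_mul]
  · rw [sdiff_eq_self_of_disjoint]
    simp [hmem, hmem_iff.not.2 hmem]

theorem DetFormulaAt.of_next_row
    (hdet : DetFormulaAt wt (dentedTrapezoid x u h) F (j + 1) (2 * x + 2 * u - (j + 1)))
    (hF : ∀ i, IsPathGF wt (2 * h i) (F i)) (hb : b ≤ 0) (hbj : Even (b + j)) :
    DetFormulaAt wt (dentedTrapezoid x u h) F j b := by
  intro p hp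
  have hnonneg {t : UnitTriangle} (ht : t ∈ dentedTrapezoid x u h) : 0 ≤ t.1 :=
    (mem_dentedTrapezoid.1 ht).1
  have hright {t : UnitTriangle} (ht : t ∈ dentedTrapezoid x u h) :
      t.2 = j + 1 → t.1 ≤ 2 * x + 2 * u - (j + 1) := by
    have := (mem_dentedTrapezoid.1 ht).2.2.2.1
    lia
  by_cases hstuck : (0, j) ∈ remainingRegion (dentedTrapezoid x u h) p j b
  · obtain ⟨hR, hloc, hfree⟩ := mem_remainingRegion.1 hstuck
    obtain rfl : b = 0 := by lia
    rw [zero_add] at hbj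
    obtain ⟨i, hi⟩ := (mem_dentedTrapezoid.1 hR).2.2.2.2.2 rfl hbj
    have hzero : tilingGF (remainingRegion (dentedTrapezoid x u h) p j 0) wt = 0 := by
      rw [tilingGF_of_isUp wt (by simpa [UnitTriangle.IsUp] using hbj) hstuck, if_neg] <;>
        simp [mem_remainingRegion, mem_dentedTrapezoid]
    rw [hzero, det_pathMatrix_eq_zero_of_column i]
    intro k
    have hloc := hp.location k
    obtain hlt | hge := lt_or_ge j (p k).2
    · exact (hF i).eq_zero_of_lt _ _ (hi ▸ hlt)
    · have hfst : (p k).1 = 0 := by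
        have := hnonneg (hp.mem k)
        lia
      have hsnd : (p k).2 ≠ 2 * h i := fun heq ↦ hfree k (Prod.ext hfst (heq.trans hi.symm))
      rw [show p k = (0, (p k).2) from Prod.ext hfst rfl, (hF i).axis, if_neg hsnd]
  · rw [← hdet p (hp.next_row hb fun t ht ↦ ⟨hnonneg ht, hright ht⟩), remainingRegion_next_row]
    · exact fun t ht ↦ hright ht
    · intro t ht hrow hle
      by_contra! hne
      have := hnonneg ht
      obtain rfl : t = (0, j) := Prod.ext (by lia) hrow
      exact hstuck (mem_remainingRegion.2 ⟨ht, .inr ⟨rfl, hle⟩, hne⟩)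

theorem DetFormulaAt.of_top (hF : ∀ i, IsPathGF wt (2 * h i) (F i)) (hmono : StrictMono h)
    (hj : 2 * u < j) : DetFormulaAt wt (dentedTrapezoid x u h) F j b := by
  intro p hp
  have hempty : remainingRegion (dentedTrapezoid x u h) p j b = ∅ := by
    refine eq_empty_of_forall_notMem fun t ht ↦ ?_
    rw [mem_remainingRegion, mem_dentedTrapezoid] at ht
    lia
  have hend : ∀ k, ∃ i, p k = ((0 : ℤ), 2 * (h i : ℤ)) := by
    intro k
    have hloc := hp.location k
    have hup := hp.isUp k
    have hmem := mem_dentedTrapezoid.1 (hp.mem k)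
    rw [UnitTriangle.IsUp] at hup
    have hfst : (p k).1 = 0 := by lia
    rw [hfst, zero_add] at hup
    obtain ⟨i, hi⟩ := hmem.2.2.2.2.2 hfst hup
    exact ⟨i, Prod.ext hfst hi⟩
  choose σ hσ using hend
  have hσ_id : σ = id := by
    refine StrictMono.eq_id fun k l hkl ↦ ?_
    have hsorted := hp.sorted k l hkl
    simp only [hσ, lt_self_iff_false, and_false, or_false] at hsorted
    exact hmono.lt_iff_lt.1 (by lia)
  have hone : pathMatrix F p = 1 := by
    ext k i
    simp [pathMatrix, hσ, hσ_id, (hF i).axis, hmono.injective.eq_iff, Matrix.one_apply]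
  rw [hempty, tilingGF_empty, hone, Matrix.det_one]

theorem detFormulaAt_dentedTrapezoid (hwt : ∀ t, wt (t, .left) = 1)
    (hF : ∀ i, IsPathGF wt (2 * h i) (F i)) (hpos : ∀ i, 1 ≤ h i) (hle : ∀ i, h i ≤ u)
    (hmono : StrictMono h) (j b : ℤ) (hbj : Even (b + j)) :
    DetFormulaAt wt (dentedTrapezoid x u h) F j b := by
  by_cases htop : 2 * u < j
  · exact .of_top hF hmono htop
  by_cases hb : b ≤ 0
  · refine .of_next_row (detFormulaAt_dentedTrapezoid hwt hF hpos hle hmono (j + 1) _ ?_) hF hb hbj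
    exact ⟨x + u, by ring⟩
  · have hdet : DetFormulaAt wt (dentedTrapezoid x u h) F j (b - 2) :=
      detFormulaAt_dentedTrapezoid hwt hF hpos hle hmono j _
        (by simpa [Int.even_add, Int.even_sub] using hbj)
    intro p hp
    by_cases hfree : ∀ k, p k ≠ (b, j)
    · exact hdet.of_unoccupied hwt (by lia) hbj hp hfree
    · push Not at hfree
      obtain ⟨i, hi⟩ := hfree
      exact hdet.of_occupied hF hpos hle (by lia) hbj hp hi
termination_by ((2 * u + 1 - j).toNat, b.toNat)
decreasing_by
  all_goals simp only [Prod.lex_def]; lia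

theorem tilingGF_dentedTrapezoid_sdiff (hwt : ∀ t, wt (t, .left) = 1)
    (hF : ∀ i, IsPathGF wt (2 * h i) (F i)) (hpos : ∀ i, 1 ≤ h i) (hle : ∀ i, h i ≤ u)
    (hmono : StrictMono h) {s : Fin n → ℤ} (hs : StrictMono s) (hs_even : ∀ k, Even (s k))
    (hs_pos : ∀ k, 0 < s k) (hs_le : ∀ k, s k ≤ 2 * x + 2 * u) :
    tilingGF (dentedTrapezoid x u h \ univ.image fun k ↦ (s k, 0)) wt =
      (pathMatrix F fun k ↦ (s k, 0)).det := by
  have hstate : IsPathState (dentedTrapezoid x u h) (fun k ↦ (s k, 0)) 0 (2 * x + 2 * u) := by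
    refine ⟨fun k l hkl ↦ .inr ⟨rfl, hs hkl⟩, fun k ↦ ?_, fun k ↦ ?_, fun k ↦ .inr (.inl ?_)⟩
    · have := hs_pos k
      have := hs_le k
      exact mem_dentedTrapezoid.2 (by lia)
    · simpa [UnitTriangle.IsUp] using hs_even k
    · exact ⟨rfl, hs_le k⟩
  have heven : Even (2 * x + 2 * u + 0 : ℤ) := ⟨x + u, by ring⟩
  rw [← detFormulaAt_dentedTrapezoid hwt hF hpos hle hmono 0 _ heven _ hstate]
  congr 1
  ext t
  have hrow (ht : t ∈ dentedTrapezoid x u h) : 0 < t.2 ∨ t.2 = 0 ∧ t.1 ≤ 2 * x + 2 * u := by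
    have := mem_dentedTrapezoid.1 ht
    lia
  simp only [mem_sdiff, mem_image, mem_univ, true_and, not_exists, mem_remainingRegion]
  tauto

end DeterminantFormula

section ForcedLozenges

variable {K : Type*} [Field K] {x u n N : ℕ} {h : Fin n → ℕ}

/-- The region between `D_{x,u}(h₁, …, hₙ)` and the dented trapezoid that is left after `s` rounds
of forced vertical lozenges: beyond the southeast side of `D_{x,u}(h₁, …, hₙ)`, which consists of
the points `(2N + j, j)`, it has lost the down-pointing triangles of the rows below `s` and the
up-pointing ones of the rows up to `s`. -/
noncomputable def trimmedTrapezoid (x u N : ℕ) (h : Fin n → ℕ) (s : ℕ) : Finset UnitTriangle :=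
  {t ∈ dentedTrapezoid x u h | t.1 < 2 * N + t.2 ∨ s < t.2 ∨ s = t.2 ∧ ¬ t.IsUp}

theorem mem_trimmedTrapezoid {s : ℕ} {a j : ℤ} : (a, j) ∈ trimmedTrapezoid x u N h s ↔
    (a, j) ∈ dentedTrapezoid x u h ∧ (a < 2 * N + j ∨ s < j ∨ s = j ∧ ¬ Even (a + j)) :=
  mem_filter

theorem trimmedTrapezoid_zero (hN : N + n = x + u + 1) :
    trimmedTrapezoid x u N h 0 =
      dentedTrapezoid x u h \ univ.image fun k : Fin n ↦ ((2 * N + 2 * k : ℤ), 0) := by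
  ext ⟨a, j⟩
  have hstart (hmem : (a, j) ∈ dentedTrapezoid x u h) :
      (∃ k : Fin n, (2 * N + 2 * k : ℤ) = a ∧ 0 = j) ↔ 2 * N ≤ a ∧ 0 = j ∧ Even a := by
    rw [mem_dentedTrapezoid] at hmem
    constructor
    · rintro ⟨k, rfl, rfl⟩
      exact ⟨by lia, rfl, ⟨N + k, by ring⟩⟩
    · rintro ⟨hge, rfl, m, rfl⟩
      exact ⟨⟨(m - N).toNat, by lia⟩, by simp only; lia, rfl⟩
  simp only [mem_trimmedTrapezoid, mem_sdiff, mem_image, mem_univ, true_and, Prod.mk.injEq]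
  refine and_congr_right fun hmem ↦ ?_
  rw [hstart hmem]
  have := mem_dentedTrapezoid.1 hmem
  grind

theorem trimmedTrapezoid_last (hN : N + n = x + u + 1) :
    trimmedTrapezoid x u N h n = regionD x u h := by
  ext ⟨a, j⟩
  simp only [mem_trimmedTrapezoid, regionD, dentedTrapezoid, halvedHexagonB, mem_filter, mem_sdiff,
    mem_product, mem_Icc]
  grind

/-- The down-pointing triangles beyond the southeast side in row `s`. -/
noncomputable def forcedTriangles (n N s : ℕ) : Finset UnitTriangle :=
  (Ico (s + 1) n).image fun k : ℕ ↦ ((2 * N + 2 * k - 1 - s : ℤ), (s : ℤ))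

theorem mem_forcedTriangles {s : ℕ} {a j : ℤ} : (a, j) ∈ forcedTriangles n N s ↔
    j = s ∧ ¬ Even (a + j) ∧ 2 * N + j ≤ a ∧ a + j < 2 * N + 2 * n - 1 := by
  simp only [forcedTriangles, mem_image, mem_Ico, Prod.mk.injEq]
  constructor
  · rintro ⟨k, hk, rfl, rfl⟩
    rw [Int.even_iff]
    lia
  · rintro ⟨rfl, hodd, hge, hle⟩
    rw [Int.even_iff] at hodd
    exact ⟨((a + s + 1) / 2 - N).toNat, by lia, by lia, rfl⟩

theorem forcesVertical_forcedTriangles (hN : N + n = x + u + 1) (hnu : n ≤ u) (s : ℕ) :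
    ForcesVertical (trimmedTrapezoid x u N h s) (forcedTriangles n N s) := by
  rintro ⟨a, j⟩ haj
  rw [mem_forcedTriangles] at haj
  have ha : a ≠ 0 := by lia
  have ha' : a - 1 ≠ 0 := by lia
  have ha'' : a + 1 ≠ 0 := by lia
  simp only [UnitTriangle.IsUp, mem_trimmedTrapezoid, mem_dentedTrapezoid, Int.even_iff,
    ha, ha', ha'', false_imp_iff] at haj ⊢
  refine ⟨by lia, by lia, by lia, by lia, by lia⟩

theorem trimmedTrapezoid_sdiff (hN : N + n = x + u + 1) (s : ℕ) :
    trimmedTrapezoid x u N h s \ (forcedTriangles n N s ∪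
      (forcedTriangles n N s).image fun t ↦ (t.1, t.2 + 1)) = trimmedTrapezoid x u N h (s + 1) := by
  ext ⟨a, j⟩
  have habove : (∃ t ∈ forcedTriangles n N s, (t.1, t.2 + 1) = (a, j)) ↔
      (a, j - 1) ∈ forcedTriangles n N s :=
    ⟨fun ⟨t, ht, heq⟩ ↦ by simpa [← (Prod.mk.inj heq).1, ← (Prod.mk.inj heq).2] using ht,
      fun ht ↦ ⟨_, ht, by simp⟩⟩
  simp only [mem_sdiff, mem_union, mem_image, habove, mem_forcedTriangles, mem_trimmedTrapezoid,
    mem_dentedTrapezoid, Int.even_iff]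
  grind

theorem tilingGF_trimmedTrapezoid (wt : Lozenge → K) (hN : N + n = x + u + 1) (hnu : n ≤ u)
    (s : ℕ) : tilingGF (trimmedTrapezoid x u N h 0) wt =
      (∏ r ∈ range s, ∏ k ∈ Ico (r + 1) n, wt ((2 * N + 2 * k - 1 - r, r + 1), .vertical)) *
        tilingGF (trimmedTrapezoid x u N h s) wt := by
  induction s with
  | zero => simp
  | succ s ih =>
    rw [ih, (forcesVertical_forcedTriangles hN hnu s).tilingGF_eq, trimmedTrapezoid_sdiff hN,
      prod_range_succ, mul_assoc, forcedTriangles, prod_image]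
    intro k _ l _ hkl
    have := (Prod.mk.inj hkl).1
    lia

end ForcedLozenges

section RegionD

theorem forced_mul_tilingGF_regionD {K : Type*} [Field K] {wt : Lozenge → K} {x u n N : ℕ}
    {h : Fin n → ℕ} {F : Fin n → UnitTriangle → K} (hwt : ∀ t, wt (t, .left) = 1)
    (hF : ∀ i, IsPathGF wt (2 * h i) (F i)) (hpos : ∀ i, 1 ≤ h i) (hle : ∀ i, h i ≤ u)
    (hmono : StrictMono h) (hN : N + n = x + u + 1) (hnu : n ≤ u) :
    (∏ r ∈ range n, ∏ k ∈ Ico (r + 1) n, wt ((2 * N + 2 * k - 1 - r, r + 1), .vertical)) *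
      tilingGF (regionD x u h) wt = (pathMatrix F fun k ↦ (2 * N + 2 * k, 0)).det := by
  rw [← trimmedTrapezoid_last hN, ← tilingGF_trimmedTrapezoid wt hN hnu, trimmedTrapezoid_zero hN]
  refine tilingGF_dentedTrapezoid_sdiff hwt hF hpos hle hmono (fun k l hkl ↦ ?_) (fun k ↦ ?_)
    (fun k ↦ ?_) fun k ↦ ?_
  · have := Fin.lt_def.1 hkl
    lia
  · exact ⟨N + k, by ring⟩
  · lia
  · have := k.isLt
    lia

end RegionD

section SymQInt

variable {K : Type*} [Field K] {q : K}

/-- The symmetric `q`-integer `(q ^ k - q ^ (-k)) / (q - q⁻¹)`, for all integers `k`, written as a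
Chebyshev polynomial of `q + q⁻¹` so that it also makes sense when `q ^ 2 = 1`. -/
noncomputable def symQInt (q : K) (k : ℤ) : K :=
  (Polynomial.Chebyshev.S K (k - 1)).eval (q + q⁻¹)

theorem symQInt_zero (q : K) : symQInt q 0 = 0 := by simp [symQInt]

theorem symQInt_one (q : K) : symQInt q 1 = 1 := by simp [symQInt]

theorem symQInt_neg (q : K) (k : ℤ) : symQInt q (-k) = -symQInt q k := by
  rw [symQInt, Polynomial.Chebyshev.S_neg_sub_one, Polynomial.eval_neg, symQInt]

theorem symQInt_add_two (q : K) (k : ℤ) :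
    symQInt q (k + 2) = (q + q⁻¹) * symQInt q (k + 1) - symQInt q k := by
  simp only [symQInt, show k + 2 - 1 = k - 1 + 2 by ring, Polynomial.Chebyshev.S_add_two,
    show k - 1 + 1 = k + 1 - 1 by ring, Polynomial.eval_sub, Polynomial.eval_mul,
    Polynomial.eval_X]

theorem symQInt_add_one (hq0 : q ≠ 0) (k : ℤ) :
    symQInt q (k + 1) = q * symQInt q k + q ^ (-k) := by
  induction k using Int.induction_on with
  | zero => simp [symQInt_zero, symQInt_one]
  | succ m ih =>
    rw [show (m + 1 + 1 : ℤ) = m + 2 by ring, symQInt_add_two, ih, neg_add, zpow_add₀ hq0,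
      zpow_neg_one]
    field_simp
    ring
  | pred m ih =>
    have hrec := symQInt_add_two q (-m - 1)
    rw [show (-m - 1 + 2 : ℤ) = -m + 1 by ring, ih, sub_add_cancel, neg_neg] at hrec
    rw [sub_add_cancel, neg_sub, sub_neg_eq_add, zpow_add₀ hq0, zpow_one]
    linear_combination -q * hrec - symQInt q (-m) * mul_inv_cancel₀ hq0

theorem symQInt_add (hq0 : q ≠ 0) (a b : ℤ) :
    symQInt q (a + b) = q ^ a * symQInt q b + q ^ (-b) * symQInt q a := by
  have hstep (a : ℤ) : symQInt q (a + b) = q ^ a * symQInt q b + q ^ (-b) * symQInt q a ↔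
      symQInt q (a + 1 + b) = q ^ (a + 1) * symQInt q b + q ^ (-b) * symQInt q (a + 1) := by
    rw [add_right_comm, symQInt_add_one hq0, symQInt_add_one hq0, zpow_add_one₀ hq0, neg_add,
      zpow_add₀ hq0, ← mul_right_inj' hq0]
    constructor <;> intro h <;> linear_combination h
  induction a using Int.induction_on with
  | zero => simp [symQInt_zero]
  | succ m ih => exact (hstep m).1 ih
  | pred m ih => exact (hstep _).2 (by simpa only [sub_add_cancel] using ih)

theorem qInt_sq_eq_zpow_mul_symQInt (hq0 : q ≠ 0) (k : ℕ) :
    qInt (q ^ 2) k = q ^ ((k : ℤ) - 1) * symQInt q k := by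
  induction k with
  | zero => simp [qInt, symQInt_zero]
  | succ k ih =>
    have hsucc : qInt (q ^ 2) (k + 1) = q ^ 2 * qInt (q ^ 2) k + 1 := by
      simp only [qInt, sum_range_succ', mul_sum, pow_succ', pow_zero]
    have hinv : q ^ (k : ℤ) * q ^ (-k : ℤ) = 1 := by rw [← zpow_add₀ hq0, add_neg_cancel, zpow_zero]
    rw [hsucc, ih, Nat.cast_add_one, add_sub_cancel_right, symQInt_add_one hq0, zpow_sub_one₀ hq0]
    field_simp
    linear_combination -hinv

theorem symQInt_two_mul (hq0 : q ≠ 0) (k : ℤ) :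
    symQInt q (2 * k) = (q ^ k + q ^ (-k)) * symQInt q k := by
  rw [two_mul, symQInt_add hq0]
  ring

theorem symQInt_mul_sub_mul (hq0 : q ≠ 0) (a b t : ℤ) :
    symQInt q (a + t) * symQInt q (b + t) - symQInt q a * symQInt q b =
      symQInt q t * symQInt q (a + b + t) := by
  have hinv : q ^ t * q ^ (-t) = 1 := by rw [← zpow_add₀ hq0, add_neg_cancel, zpow_zero]
  rw [add_right_comm, symQInt_add hq0 (a + t) b, symQInt_add hq0 a t, add_comm b t,
    symQInt_add hq0 t b, zpow_add₀ hq0 a t]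
  linear_combination symQInt q a * symQInt q b * hinv

theorem symQInt_add_one_sub (hq0 : q ≠ 0) (k : ℤ) :
    symQInt q (k + 1) - symQInt q (k - 1) = q ^ k + q ^ (-k) := by
  have hleft : symQInt q (k + 1) = q * symQInt q k + q ^ (-k) := symQInt_add_one hq0 k
  have hright : symQInt q (k + 1) = q ^ k + q⁻¹ * symQInt q k := by
    simpa [symQInt_one] using symQInt_add hq0 k 1
  have hrec : symQInt q (k + 1) = (q + q⁻¹) * symQInt q k - symQInt q (k - 1) := by
    simpa [show k - 1 + 2 = k + 1 by ring] using symQInt_add_two q (k - 1)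
  linear_combination hleft + hright - hrec

theorem symQInt_ne_zero (hq0 : q ≠ 0) (hq : ∀ k : ℕ, 1 ≤ k → qInt (q ^ 2) k ≠ 0) {k : ℤ}
    (hk : k ≠ 0) : symQInt q k ≠ 0 := by
  have hnat (m : ℕ) (hm : m ≠ 0) : symQInt q m ≠ 0 :=
    right_ne_zero_of_mul (qInt_sq_eq_zpow_mul_symQInt hq0 m ▸ hq m (by lia))
  obtain ⟨m, rfl | rfl⟩ := k.eq_nat_or_neg
  · exact hnat m (by lia)
  · rw [symQInt_neg]
    exact neg_ne_zero.2 (hnat m (by lia))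

end SymQInt

section AxisPaths

variable {K : Type*} [Field K] {q : K}

/-- The generating function, with respect to `wt₂ q`, of the lattice paths that start at abscissa
`b` and arrive at the `j`-axis `d` rows further up. -/
noncomputable def axisPathGF (q : K) : ℕ → ℤ → K
  | 0, _ => 1
  | d + 1, b => (2 ^ (d + 1))⁻¹ * (symQInt q b * ∏ i ∈ range d, symQInt q (b + d - 1 - 2 * i)) /
      ∏ i ∈ range (d + 1), symQInt q (i + 1)

theorem axisPathGF_zero (q : K) (b : ℤ) : axisPathGF q 0 b = 1 := rfl

theorem axisPathGF_succ (q : K) (d : ℕ) (b : ℤ) : axisPathGF q (d + 1) b =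
    (2 ^ (d + 1))⁻¹ * (symQInt q b * ∏ i ∈ range d, symQInt q (b + d - 1 - 2 * i)) /
      ∏ i ∈ range (d + 1), symQInt q (i + 1) := rfl

theorem axisPathGF_one (q : K) (b : ℤ) : axisPathGF q 1 b = symQInt q b / 2 := by
  simp [axisPathGF, symQInt_one, div_eq_inv_mul]

theorem axisPathGF_succ_zero (q : K) (d : ℕ) : axisPathGF q (d + 1) 0 = 0 := by
  simp [axisPathGF, symQInt_zero]

theorem axisPathGF_succ_eq_zero (q : K) {d m : ℕ} (hm : m < d) {b : ℤ} (hb : b + d - 1 = 2 * m) :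
    axisPathGF q (d + 1) b = 0 := by
  rw [axisPathGF_succ, prod_eq_zero (mem_range.2 hm) (by rw [hb, sub_self, symQInt_zero]),
    mul_zero, mul_zero, zero_div]

theorem axisPathGF_succ_one_of_even (q : K) {d : ℕ} (hd : Even d) :
    axisPathGF q (d + 1) 1 = 1 / 2 * axisPathGF q d 0 := by
  obtain ⟨m, rfl⟩ := hd
  cases m with
  | zero => simp [axisPathGF_one, axisPathGF_zero, symQInt_one]
  | succ m =>
    rw [axisPathGF_succ_eq_zero q (m := m + 1) (by lia) (by push_cast; ring), ← add_assoc,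
      axisPathGF_succ_zero, mul_zero]

theorem axisPathGF_step [NeZero (2 : K)] (hq0 : q ≠ 0)
    (hq : ∀ k : ℕ, 1 ≤ k → qInt (q ^ 2) k ≠ 0) (d : ℕ) (b : ℤ) :
    axisPathGF q (d + 1) b =
      (q ^ (b - 1) + q ^ (-(b - 1))) / 2 * axisPathGF q d (b - 1) +
        axisPathGF q (d + 1) (b - 2) := by
  cases d with
  | zero =>
    have hdiff := symQInt_add_one_sub hq0 (b - 1)
    rw [sub_add_cancel, sub_sub, one_add_one_eq_two] at hdiff
    rw [axisPathGF_one, axisPathGF_one, axisPathGF_zero]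
    linear_combination hdiff / 2
  | succ d =>
    have hfactor : symQInt q b * symQInt q (b + d) - symQInt q (b - 2 - d) * symQInt q (b - 2) =
        symQInt q (d + 2) * ((q ^ (b - 1) + q ^ (-(b - 1))) * symQInt q (b - 1)) := by
      have hsub := symQInt_mul_sub_mul hq0 (b - 2 - d) (b - 2) (d + 2)
      rwa [show b - 2 - d + (b - 2) + (d + 2) = 2 * (b - 1) by ring, symQInt_two_mul hq0,
        show b - 2 - d + (d + 2) = b by ring, show b - 2 + (d + 2 : ℤ) = b + d by ring] at hsub
    have htop : ∏ i ∈ range (d + 1), symQInt q (b + (d + 1 : ℕ) - 1 - 2 * i) =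
        (∏ i ∈ range d, symQInt q (b - 1 + d - 1 - 2 * i)) * symQInt q (b + d) := by
      rw [prod_range_succ']
      refine congrArg₂ _ (prod_congr rfl fun i _ ↦ congrArg _ ?_) (congrArg _ ?_) <;>
        push_cast <;> ring
    have hbottom : ∏ i ∈ range (d + 1), symQInt q (b - 2 + (d + 1 : ℕ) - 1 - 2 * i) =
        (∏ i ∈ range d, symQInt q (b - 1 + d - 1 - 2 * i)) * symQInt q (b - 2 - d) := by
      rw [prod_range_succ]
      refine congrArg₂ _ (prod_congr rfl fun i _ ↦ congrArg _ ?_) (congrArg _ ?_) <;>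
        push_cast <;> ring
    have hdenom : ∏ i ∈ range (d + 1), symQInt q (i + 1) ≠ 0 :=
      prod_ne_zero_iff.2 fun i _ ↦ symQInt_ne_zero hq0 hq (by lia)
    have hlast : symQInt q (d + 2) ≠ 0 := symQInt_ne_zero hq0 hq (by lia)
    rw [axisPathGF_succ, axisPathGF_succ, axisPathGF_succ, prod_range_succ _ (d + 1), htop, hbottom,
      show ((d + 1 : ℕ) : ℤ) + 1 = d + 2 by push_cast; ring]
    field_simp
    linear_combination (2 ^ (d + 2) *
      ∏ i ∈ range d, symQInt q (b - 1 + d - 1 - 2 * i)) * hfactor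

/-- The generating function, with respect to `wt₂ q`, of the lattice paths from a triangle to the
`j`-axis at height `e`. -/
noncomputable def dentPathGF (q : K) (e : ℤ) (t : UnitTriangle) : K :=
  if t.1 < 0 ∨ e < t.2 then 0 else axisPathGF q (e - t.2).toNat t.1

theorem dentPathGF_of_le (q : K) {e a j : ℤ} (ha : 0 ≤ a) {d : ℕ} (hd : e = j + d) :
    dentPathGF q e (a, j) = axisPathGF q d a := by
  rw [dentPathGF, if_neg (by lia), hd, add_sub_cancel_left, Int.toNat_natCast]

theorem isPathGF_dentPathGF [NeZero (2 : K)] (hq0 : q ≠ 0)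
    (hq : ∀ k : ℕ, 1 ≤ k → qInt (q ^ 2) k ≠ 0) {e : ℤ} (he : Even e) :
    IsPathGF (wt₂ q) e (dentPathGF q e) where
  eq_zero_of_neg a j ha := by simp [dentPathGF, ha]
  eq_zero_of_lt a j hj := by simp [dentPathGF, hj]
  axis j := by
    rcases lt_or_ge e j with hej | hje
    · rw [dentPathGF, if_pos (.inr hej), if_neg (by lia)]
    · obtain ⟨d, hd⟩ := Int.le.dest hje
      rw [dentPathGF_of_le q le_rfl hd.symm]
      cases d with
      | zero => rw [axisPathGF_zero, if_pos (by lia)]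
      | succ d => rw [axisPathGF_succ_zero, if_neg (by lia)]
  step a j ha haj := by
    have hright : wt₂ q ((a - 2, j), .right) = 1 := rfl
    rw [hright, one_mul]
    rcases lt_or_ge e j with hej | hje
    · simp [dentPathGF, hej, hej.trans (lt_add_one j)]
    obtain ⟨d, hd⟩ := Int.le.dest hje
    cases d with
    | zero =>
      have ha2 : 0 ≤ a - 2 := by
        rw [Int.even_iff] at haj he
        lia
      rw [dentPathGF_of_le q (by lia) hd.symm, dentPathGF_of_le q ha2 hd.symm, axisPathGF_zero,
        axisPathGF_zero, dentPathGF, if_pos (.inr (by lia)), mul_zero, zero_add]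
    | succ d =>
      rw [dentPathGF_of_le q (by lia) hd.symm,
        dentPathGF_of_le q (by lia : 0 ≤ a - 1) (by lia : e = j + 1 + d)]
      obtain rfl | ha1 := ha.eq_or_lt
      · have hd_even : Even d := by
          rw [Int.even_iff] at haj he
          rw [Nat.even_iff]
          lia
        rw [axisPathGF_succ_one_of_even q hd_even, dentPathGF, if_pos (.inl (by lia)), add_zero]
        rfl
      · rw [dentPathGF_of_le q (by lia) hd.symm, axisPathGF_step hq0 hq, wt₂, if_neg (by lia)]

end AxisPaths

section LinearFormsDeterminant

variable {R : Type*} [CommRing R]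

theorem exists_coeff_prod_linearForm {ι : Type*} (s : Finset ι) (a b : ι → R) :
    ∃ c : ℕ → R, ∀ v w : R,
      ∏ i ∈ s, (a i * v + b i * w) = ∑ m ∈ range (#s + 1), c m * (v ^ m * w ^ (#s - m)) := by
  classical
  refine ⟨fun m ↦ ∑ t ∈ powersetCard m s, (∏ i ∈ t, a i) * ∏ i ∈ s \ t, b i, fun v w ↦ ?_⟩
  rw [prod_add, sum_powerset]
  refine sum_congr rfl fun m _ ↦ ?_
  rw [sum_mul]
  refine sum_congr rfl fun t ht ↦ ?_
  obtain ⟨hts, htm⟩ := mem_powersetCard.1 ht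
  rw [prod_mul_distrib, prod_mul_distrib, prod_const, prod_const, card_sdiff_of_subset hts, htm]
  ring

/-- The matrix whose entry `(k, i)` is the product of the linear forms `α l * X + β l * Y` with
`l < k` and `γ l * X + δ l * Y` with `k < l`, evaluated at `(v i, w i)`. -/
def linearFormMatrix {n : ℕ} (α β γ δ v w : Fin n → R) : Matrix (Fin n) (Fin n) R :=
  Matrix.of fun k i ↦ (∏ l ∈ Iio k, (α l * v i + β l * w i)) * ∏ l ∈ Ioi k, (γ l * v i + δ l * w i)

theorem exists_linearFormMatrix_eq_mul_projVandermonde {n : ℕ} (α β γ δ : Fin n → R) :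
    ∃ C : Matrix (Fin n) (Fin n) R, ∀ v w : Fin n → R,
      linearFormMatrix α β γ δ v w = C * (Matrix.projVandermonde v w).transpose := by
  choose c hc using fun k : Fin n ↦
    exists_coeff_prod_linearForm ((Iio k).disjSum (Ioi k)) (Sum.elim α γ) (Sum.elim β δ)
  refine ⟨Matrix.of fun k m ↦ c k m, fun v w ↦ Matrix.ext fun k i ↦ ?_⟩
  have hdeg : #((Iio k).disjSum (Ioi k)) + 1 = n := by
    rw [card_disjSum, Fin.card_Iio, Fin.card_Ioi]
    lia
  have hentry := hc k (v i) (w i)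
  simp only [prod_disjSum, Sum.elim_inl, Sum.elim_inr, hdeg] at hentry
  rw [linearFormMatrix, Matrix.of_apply, hentry, Matrix.mul_apply, sum_range]
  refine sum_congr rfl fun m _ ↦ ?_
  rw [Matrix.of_apply, Matrix.transpose_apply, Matrix.projVandermonde_apply, Fin.val_rev]
  congr 3
  lia

/-- At the zeros of the forms `γ l * X + δ l * Y` the matrix is lower triangular. -/
theorem det_linearFormMatrix_of_zeros {n : ℕ} (α β γ δ : Fin n → R) :
    (linearFormMatrix α β γ δ δ (-γ)).det =
      (∏ k, ∏ l ∈ Iio k, (α l * δ k - β l * γ k)) *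
        ∏ k, ∏ l ∈ Ioi k, (δ l * -γ k - δ k * -γ l) := by
  have htri : (linearFormMatrix α β γ δ δ (-γ)).IsLowerTriangular := by
    intro k i hki
    have hzero : γ i * δ i + δ i * (-γ) i = 0 := by
      rw [Pi.neg_apply]
      ring
    exact mul_eq_zero_of_right _ (prod_eq_zero (mem_Ioi.2 hki) hzero)
  rw [Matrix.det_of_isLowerTriangular _ htri, ← prod_mul_distrib]
  refine prod_congr rfl fun k _ ↦ ?_
  simp only [linearFormMatrix, Matrix.of_apply, Pi.neg_apply]
  refine congrArg₂ _ (prod_congr rfl fun l _ ↦ ?_) (prod_congr rfl fun l _ ↦ ?_) <;> ring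

theorem det_linearFormMatrix [IsDomain R] {n : ℕ} (α β γ δ v w : Fin n → R)
    (hγδ : ∀ k, ∀ l ∈ Ioi k, δ l * -γ k - δ k * -γ l ≠ 0) :
    (linearFormMatrix α β γ δ v w).det =
      (∏ k, ∏ l ∈ Iio k, (α l * δ k - β l * γ k)) *
        ∏ i, ∏ j ∈ Ioi i, (v j * w i - v i * w j) := by
  obtain ⟨C, hC⟩ := exists_linearFormMatrix_eq_mul_projVandermonde α β γ δ
  have hdet (v w : Fin n → R) : (linearFormMatrix α β γ δ v w).det =
      C.det * ∏ i, ∏ j ∈ Ioi i, (v j * w i - v i * w j) := by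
    rw [hC, Matrix.det_mul, Matrix.det_transpose, Matrix.det_projVandermonde]
  have hCdet : C.det = ∏ k, ∏ l ∈ Iio k, (α l * δ k - β l * γ k) :=
    mul_right_cancel₀ (prod_ne_zero_iff.2 fun k _ ↦ prod_ne_zero_iff.2 (hγδ k))
      ((hdet δ (-γ)).symm.trans (det_linearFormMatrix_of_zeros α β γ δ))
  rw [hdet, hCdet]

end LinearFormsDeterminant

section CrossMatrix

variable {K : Type*} [Field K] {q : K}

/-- The matrix with entries `∏_{l < k} [2(N + l + hᵢ)] ∏_{l > k} [2(N + l - hᵢ)]`. -/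
noncomputable def crossMatrix (q : K) (N : ℤ) {n : ℕ} (h : Fin n → ℤ) : Matrix (Fin n) (Fin n) K :=
  Matrix.of fun k i ↦ (∏ l ∈ Iio k, symQInt q (2 * (N + l + h i))) *
    ∏ l ∈ Ioi k, symQInt q (2 * (N + l - h i))

theorem crossMatrix_eq_linearFormMatrix (hq0 : q ≠ 0) (N : ℤ) {n : ℕ} (h : Fin n → ℤ) :
    crossMatrix q N h = linearFormMatrix (fun l ↦ q ^ (-(2 * (N + l))))
      (fun l ↦ symQInt q (2 * (N + l))) (fun l ↦ -q ^ (2 * (N + l)))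
      (fun l ↦ symQInt q (2 * (N + l))) (fun i ↦ symQInt q (2 * h i)) fun i ↦ q ^ (2 * h i) := by
  have hadd (l : Fin n) (z : ℤ) : symQInt q (2 * (N + l + z)) =
      q ^ (-(2 * (N + l))) * symQInt q (2 * z) + symQInt q (2 * (N + l)) * q ^ (2 * z) := by
    rw [show 2 * (N + l + z) = 2 * z + 2 * (N + l) by ring, symQInt_add hq0]
    ring
  have hsub (l : Fin n) (z : ℤ) : symQInt q (2 * (N + l - z)) =
      -q ^ (2 * (N + l)) * symQInt q (2 * z) + symQInt q (2 * (N + l)) * q ^ (2 * z) := by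
    rw [show 2 * (N + l - z) = 2 * (N + l) + -(2 * z) by ring, symQInt_add hq0, symQInt_neg,
      neg_neg]
    ring
  ext k i
  simp only [crossMatrix, linearFormMatrix, Matrix.of_apply, hadd, hsub]

theorem det_crossMatrix (hq0 : q ≠ 0) (hq : ∀ k : ℕ, 1 ≤ k → qInt (q ^ 2) k ≠ 0)
    (N : ℤ) {n : ℕ} (h : Fin n → ℤ) :
    (crossMatrix q N h).det =
      (∏ k : Fin n, ∏ l ∈ Iio k, symQInt q (2 * (2 * N + k + l))) *
        ∏ i : Fin n, ∏ j ∈ Ioi i, symQInt q (2 * (h j - h i)) := by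
  have hsub (a b : ℤ) : symQInt q (2 * (b - a)) =
      symQInt q (2 * b) * q ^ (2 * a) - symQInt q (2 * a) * q ^ (2 * b) := by
    rw [mul_sub, sub_eq_add_neg, symQInt_add hq0, symQInt_neg, neg_neg]
    ring
  have hne (k l : Fin n) (hl : l ∈ Ioi k) :
      symQInt q (2 * (N + l)) * - -q ^ (2 * (N + k)) -
        symQInt q (2 * (N + k)) * - -q ^ (2 * (N + l)) ≠ 0 := by
    have hkl := Fin.lt_def.1 (mem_Ioi.1 hl)
    rw [neg_neg, neg_neg, ← hsub]
    exact symQInt_ne_zero hq0 hq (by lia)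
  rw [crossMatrix_eq_linearFormMatrix hq0, det_linearFormMatrix _ _ _ _ _ _ hne]
  simp only [hsub (h _)]
  congr 1
  refine prod_congr rfl fun k _ ↦ prod_congr rfl fun l _ ↦ ?_
  rw [show 2 * (2 * N + k + l) = 2 * (N + k) + 2 * (N + l) by ring, symQInt_add hq0]
  ring

end CrossMatrix

section Products

variable {M : Type*} [CommMonoid M]

theorem prod_Iio_val {n : ℕ} (k : Fin n) (f : ℕ → M) : ∏ l ∈ Iio k, f l = ∏ l ∈ range k, f l := by
  rw [← Nat.Iio_eq_range, ← Fin.map_valEmbedding_Iio, prod_map]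
  rfl

theorem prod_Ioi_val {n : ℕ} (k : Fin n) (f : ℕ → M) :
    ∏ l ∈ Ioi k, f l = ∏ l ∈ Ico (k + 1 : ℕ) n, f l := by
  rw [Ico_add_one_left_eq_Ioo, ← Fin.map_valEmbedding_Ioi, prod_map]
  rfl

theorem prod_range_add_mul_prod_range (f : ℕ → M) (k h : ℕ) :
    (∏ i ∈ range h, f (k + i)) * ∏ l ∈ range k, f l =
      (∏ i ∈ range h, f i) * ∏ l ∈ range k, f (l + h) := by
  rw [mul_comm, ← prod_range_add, add_comm k h, prod_range_add]
  simp only [add_comm h]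

theorem prod_range_sub_mul_prod_Ico (f : ℤ → M) {n k : ℕ} (hk : k < n) (h : ℕ) :
    (∏ i ∈ range h, f (k - i)) * ∏ l ∈ Ico (k + 1) n, f l =
      (∏ i ∈ range h, f (n - 1 - i)) * ∏ l ∈ Ico (k + 1) n, f (l - h) := by
  have hreflect (g : ℤ → M) :
      ∏ l ∈ Ico (k + 1) n, g l = ∏ l ∈ range (n - 1 - k), g (n - 1 - l) := by
    have hIco := prod_Ico_reflect (fun l : ℕ ↦ g l) 0 (show n - 1 - k ≤ n - 1 + 1 by lia)
    rw [show n - 1 + 1 - (n - 1 - k) = k + 1 by lia, show n - 1 + 1 - 0 = n by lia,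
      ← range_eq_Ico] at hIco
    rw [← hIco]
    refine prod_congr rfl fun l hl ↦ congrArg g ?_
    have := mem_range.1 hl
    lia
  rw [hreflect, hreflect fun l ↦ f (l - h)]
  have hshift := prod_range_add_mul_prod_range (fun i : ℕ ↦ f (n - 1 - i)) (n - 1 - k) h
  refine Eq.trans ?_ (hshift.trans ?_)
  · exact congrArg (· * _) (prod_congr rfl fun i _ ↦ congrArg f (by lia))
  · exact congrArg (_ * ·) (prod_congr rfl fun l _ ↦ congrArg f (by lia))

theorem prod_prod_Iic_mul_rev {n : ℕ} (f : Fin n → M) :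
    ∏ i, ∏ r ∈ Iic i, f r * f r.rev =
      (∏ i, (∏ l ∈ Iio i, f l) * ∏ l ∈ Ioi i, f l) * ∏ i, f i ^ 2 := by
  have hrev : ∏ i : Fin n, ∏ r ∈ Iic i, f r.rev = ∏ i : Fin n, ∏ l ∈ Ici i, f l := by
    refine Fintype.prod_equiv Fin.revPerm _ _ fun i ↦ ?_
    rw [Fin.revPerm_apply, ← Fin.map_revPerm_Iic, prod_map]
    rfl
  simp only [prod_mul_distrib]
  rw [hrev]
  simp only [← prod_Iio_mul_eq_prod_Iic, ← mul_prod_Ioi_eq_prod_Ici, prod_mul_distrib, pow_two]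
  ac_rfl

end Products

section AxisPathProduct

variable {K : Type*} [Field K] {q : K}

theorem symQInt_mul_prod_range (q : K) (M : ℤ) (h : ℕ) :
    symQInt q (2 * M) * ∏ i ∈ range (2 * h + 1), symQInt q (2 * (M + h - i)) =
      ∏ i ∈ range (h + 1), symQInt q (2 * (M + i)) * symQInt q (2 * (M - i)) := by
  induction h with
  | zero => simp
  | succ h ih =>
    rw [prod_range_succ _ (h + 1), ← ih, show 2 * (h + 1) + 1 = (2 * h + 1) + 1 + 1 by ring,
      prod_range_succ, prod_range_succ']
    push_cast
    simp only [sub_zero, add_sub_add_right_eq_sub, ← add_assoc]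
    rw [show M + h + 1 - (2 * h + 2) = M - (h + 1) by ring]
    ring

theorem axisPathGF_two_mul (q : K) (h : ℕ) (M : ℤ) :
    axisPathGF q (2 * h) (2 * M) = (4 ^ h)⁻¹ *
      (∏ i ∈ range h, symQInt q (2 * (M + i)) * symQInt q (2 * (M - i))) /
      ∏ i ∈ range (2 * h), symQInt q (i + 1) := by
  cases h with
  | zero => simp [axisPathGF]
  | succ h =>
    have hprod : ∏ i ∈ range (2 * h + 1), symQInt q (2 * (M + h - i)) =
        ∏ i ∈ range (2 * h + 1), symQInt q (2 * M + (2 * h + 1 : ℕ) - 1 - 2 * i) :=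
      prod_congr rfl fun i _ ↦ congrArg (symQInt q) (by push_cast; ring)
    rw [← symQInt_mul_prod_range, hprod, show 2 * (h + 1) = 2 * h + 1 + 1 by ring,
      axisPathGF_succ, show 2 * h + 1 + 1 = 2 * (h + 1) by ring, pow_mul]
    norm_num

theorem axisPathGF_mul_eq_mul_crossMatrix (q : K) (N : ℤ) {n : ℕ} (h : Fin n → ℕ) (k i : Fin n) :
    ((∏ l ∈ Iio k, symQInt q (2 * (N + l))) * ∏ l ∈ Ioi k, symQInt q (2 * (N + l))) *
        axisPathGF q (2 * h i) (2 * (N + k)) =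
      ((4 ^ h i)⁻¹ *
          (∏ r ∈ range (h i), symQInt q (2 * (N + r)) * symQInt q (2 * (N + (n - 1 - r)))) /
        ∏ r ∈ range (2 * h i), symQInt q (r + 1)) * crossMatrix q N (fun i ↦ h i) k i := by
  have hup := prod_range_add_mul_prod_range (fun l ↦ symQInt q (2 * (N + l))) k (h i)
  have hdown := prod_range_sub_mul_prod_Ico (fun z ↦ symQInt q (2 * (N + z))) k.isLt (h i)
  rw [axisPathGF_two_mul, crossMatrix, Matrix.of_apply,
    prod_Iio_val k fun l ↦ symQInt q (2 * (N + l)),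
    prod_Ioi_val k fun l ↦ symQInt q (2 * (N + l)),
    prod_Iio_val k fun l ↦ symQInt q (2 * (N + l + h i)),
    prod_Ioi_val k fun l ↦ symQInt q (2 * (N + l - h i)), prod_mul_distrib, prod_mul_distrib]
  simp only [Nat.cast_add, ← add_assoc, ← add_sub_assoc] at hup hdown ⊢
  set D := ∏ r ∈ range (2 * h i), symQInt q (r + 1)
  simp only [div_eq_mul_inv]
  linear_combination
    (4 ^ h i)⁻¹ * D⁻¹ * (∏ r ∈ range (h i), symQInt q (2 * (N + k + r))) *
        (∏ l ∈ range k, symQInt q (2 * (N + l))) * hdown +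
      (4 ^ h i)⁻¹ * D⁻¹ * (∏ r ∈ range (h i), symQInt q (2 * (N + n - 1 - r))) *
        (∏ l ∈ Ico (k + 1 : ℕ) n, symQInt q (2 * (N + l - h i))) * hup

end AxisPathProduct

section TilingProduct

variable {K : Type*} [Field K] {q : K}

theorem prod_forced_wt₂ (q : K) {N : ℕ} (hN : 0 < N) (n : ℕ) :
    ∏ r ∈ range n, ∏ k ∈ Ico (r + 1) n, wt₂ q ((2 * N + 2 * k - 1 - r, r + 1), .vertical) =
      ∏ k : Fin n, ∏ l ∈ Iio k, (q ^ (2 * N + k + l : ℤ) + q ^ (-(2 * N + k + l : ℤ))) / 2 := by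
  have hreflect (k : ℕ) : ∏ r ∈ range k, wt₂ q ((2 * N + 2 * k - 1 - r, r + 1), .vertical) =
      ∏ l ∈ range k, (q ^ (2 * N + k + l : ℤ) + q ^ (-(2 * N + k + l : ℤ))) / 2 := by
    rw [← prod_range_reflect]
    refine prod_congr rfl fun l hl ↦ ?_
    have hlk := mem_range.1 hl
    rw [wt₂, if_neg (by lia),
      show (2 * N + 2 * k - 1 - (k - 1 - l : ℕ) : ℤ) = 2 * N + k + l by lia]
  rw [prod_comm' (t' := range n) (s' := range) (by simp only [mem_range, mem_Ico]; lia),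
    prod_range]
  refine prod_congr rfl fun k _ ↦ ?_
  rw [hreflect, prod_Iio_val k fun l ↦ (q ^ (2 * N + k + l : ℤ) + q ^ (-(2 * N + k + l : ℤ))) / 2]

theorem pathMatrix_dentPathGF (q : K) (N : ℕ) {n : ℕ} (h : Fin n → ℕ) :
    (pathMatrix (fun i ↦ dentPathGF q (2 * h i)) fun k ↦ (2 * N + 2 * k, 0)) =
      Matrix.of fun k i : Fin n ↦ axisPathGF q (2 * h i) (2 * ((N : ℤ) + (k : ℕ))) := by
  ext k i
  rw [pathMatrix, Matrix.of_apply, Matrix.of_apply,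
    dentPathGF_of_le q (by lia) (d := 2 * h i) (by push_cast; ring), mul_add]

theorem prod_mul_det_axisPathGF (hq0 : q ≠ 0) (hq : ∀ k : ℕ, 1 ≤ k → qInt (q ^ 2) k ≠ 0)
    (N : ℤ) {n : ℕ} (h : Fin n → ℕ) :
    (∏ k : Fin n, (∏ l ∈ Iio k, symQInt q (2 * (N + l))) * ∏ l ∈ Ioi k, symQInt q (2 * (N + l))) *
        (Matrix.of fun k i : Fin n ↦ axisPathGF q (2 * h i) (2 * (N + k))).det =
      (∏ i : Fin n, (4 ^ h i)⁻¹ *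
          (∏ r ∈ range (h i), symQInt q (2 * (N + r)) * symQInt q (2 * (N + (n - 1 - r)))) /
        ∏ r ∈ range (2 * h i), symQInt q (r + 1)) *
      ((∏ k : Fin n, ∏ l ∈ Iio k, symQInt q (2 * (2 * N + k + l))) *
        ∏ i : Fin n, ∏ j ∈ Ioi i, symQInt q (2 * (h j - h i))) := by
  rw [← det_crossMatrix hq0 hq N fun i ↦ (h i : ℤ), ← Matrix.det_mul_column,
    ← Matrix.det_mul_row]
  congr 1
  ext k i
  exact axisPathGF_mul_eq_mul_crossMatrix q N h k i

theorem prod_mul_tilingGF_regionD [NeZero (2 : K)] (hq0 : q ≠ 0)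
    (hq : ∀ k : ℕ, 1 ≤ k → qInt (q ^ 2) k ≠ 0) {x u n N : ℕ} (hnu : n ≤ u)
    (hN : N + n = x + u + 1) {h : Fin n → ℕ} (hmono : StrictMono h) (hpos : ∀ i, 1 ≤ h i)
    (hle : ∀ i, h i ≤ u) :
    (∏ k : Fin n, (∏ l ∈ Iio k, symQInt q (2 * (N + l))) * ∏ l ∈ Ioi k, symQInt q (2 * (N + l))) *
        tilingGF (regionD x u h) (wt₂ q) =
      (∏ i : Fin n, (4 ^ h i)⁻¹ *
          (∏ r ∈ range (h i), symQInt q (2 * (N + r)) * symQInt q (2 * (N + (n - 1 - r)))) /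
        ∏ r ∈ range (2 * h i), symQInt q (r + 1)) *
      ((∏ k : Fin n, ∏ l ∈ Iio k, 2 * symQInt q (2 * N + k + l)) *
        ∏ i : Fin n, ∏ j ∈ Ioi i, symQInt q (2 * (h j - h i))) := by
  have hN0 : 0 < N := by lia
  set forced : K :=
    ∏ k : Fin n, ∏ l ∈ Iio k, (q ^ (2 * N + k + l : ℤ) + q ^ (-(2 * N + k + l : ℤ))) / 2
    with hforced
  have hdet : forced * tilingGF (regionD x u h) (wt₂ q) =
      (Matrix.of fun k i : Fin n ↦ axisPathGF q (2 * h i) (2 * ((N : ℤ) + (k : ℕ)))).det := by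
    rw [hforced, ← prod_forced_wt₂ q hN0 n, ← pathMatrix_dentPathGF]
    exact forced_mul_tilingGF_regionD (wt := wt₂ q) (fun _ ↦ rfl)
      (fun i ↦ isPathGF_dentPathGF hq0 hq (even_two_mul _)) hpos hle hmono hN hnu
  have hdouble : ∏ k : Fin n, ∏ l ∈ Iio k, symQInt q (2 * (2 * N + k + l)) =
      forced * ∏ k : Fin n, ∏ l ∈ Iio k, 2 * symQInt q (2 * N + k + l) := by
    simp only [hforced, ← prod_mul_distrib]
    refine prod_congr rfl fun k _ ↦ prod_congr rfl fun l _ ↦ ?_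
    rw [symQInt_two_mul hq0]
    field_simp
  have hforced0 : forced ≠ 0 := by
    refine left_ne_zero_of_mul (b := ∏ k : Fin n, ∏ l ∈ Iio k, 2 * symQInt q (2 * N + k + l)) ?_
    rw [← hdouble]
    exact prod_ne_zero_iff.2 fun k _ ↦ prod_ne_zero_iff.2 fun l _ ↦ symQInt_ne_zero hq0 hq (by lia)
  have hcross := prod_mul_det_axisPathGF hq0 hq N h
  rw [← hdet, hdouble] at hcross
  refine mul_left_cancel₀ hforced0 ?_
  linear_combination hcross

/-- The product `P(x, u, 0, ∅, h)` written with symmetric `q`-integers, so that no separate power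
of `q` is left; here `N` stands for `x + u - n + 1`. -/
noncomputable def symProdP (q : K) (N : ℤ) {n : ℕ} (h : Fin n → ℕ) : K :=
  (∏ i : Fin n, (4 ^ h i)⁻¹ * 2 ^ (i : ℕ)) *
    ((∏ i : Fin n, ∏ j ∈ Ioi i, symQInt q (2 * (h j - h i))) /
      ∏ i : Fin n, ∏ r ∈ range (2 * h i), symQInt q (r + 1)) *
    (∏ i : Fin n, symQInt q (2 * (N + i))) *
    (∏ i : Fin n, ∏ l ∈ range (i + 1 : ℕ), symQInt q (2 * N + i + l)) *
    ∏ i : Fin n, ∏ r ∈ Ico (i + 1 : ℕ) (h i),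
      symQInt q (2 * (N + r)) * symQInt q (2 * (N + (n - 1 - r)))

theorem prod_prod_range_eq_mul_prod_Ico (q : K) (N : ℤ) {n : ℕ} {h : Fin n → ℕ}
    (hle : ∀ i : Fin n, (i : ℕ) + 1 ≤ h i) :
    ∏ i : Fin n, ∏ r ∈ range (h i), symQInt q (2 * (N + r)) * symQInt q (2 * (N + (n - 1 - r))) =
      (∏ i : Fin n,
        (∏ l ∈ Iio i, symQInt q (2 * (N + l))) * ∏ l ∈ Ioi i, symQInt q (2 * (N + l))) *
      (∏ i : Fin n, symQInt q (2 * (N + i)) ^ 2) *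
      ∏ i : Fin n, ∏ r ∈ Ico (i + 1 : ℕ) (h i),
        symQInt q (2 * (N + r)) * symQInt q (2 * (N + (n - 1 - r))) := by
  rw [← prod_prod_Iic_mul_rev fun l : Fin n ↦ symQInt q (2 * (N + l)), ← prod_mul_distrib]
  refine prod_congr rfl fun i _ ↦ ?_
  rw [← prod_range_mul_prod_Ico _ (hle i)]
  congr 1
  rw [Nat.range_succ_eq_Iic, ← Fin.map_valEmbedding_Iic, prod_map]
  refine prod_congr rfl fun r _ ↦ ?_
  have hrev : ((n - (r + 1) : ℕ) : ℤ) = n - 1 - r := by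
    have := r.isLt
    lia
  rw [Fin.val_rev, Fin.valEmbedding_apply, hrev]

theorem tilingGF_regionD_eq_symProdP [NeZero (2 : K)] (hq0 : q ≠ 0)
    (hq : ∀ k : ℕ, 1 ≤ k → qInt (q ^ 2) k ≠ 0) {x u n N : ℕ} (hnu : n ≤ u)
    (hN : N + n = x + u + 1) {h : Fin n → ℕ} (hmono : StrictMono h)
    (hge : ∀ i : Fin n, (i : ℕ) + 1 ≤ h i) (hle : ∀ i, h i ≤ u) :
    tilingGF (regionD x u h) (wt₂ q) = symProdP q N h := by
  have hcol : ∏ k : Fin n, (∏ l ∈ Iio k, symQInt q (2 * (N + l))) *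
      ∏ l ∈ Ioi k, symQInt q (2 * (N + l)) ≠ 0 :=
    prod_ne_zero_iff.2 fun k _ ↦ mul_ne_zero
      (prod_ne_zero_iff.2 fun l _ ↦ symQInt_ne_zero hq0 hq (by lia))
      (prod_ne_zero_iff.2 fun l _ ↦ symQInt_ne_zero hq0 hq (by lia))
  have htwo : ∏ k : Fin n, ∏ l ∈ Iio k, 2 * symQInt q (2 * N + k + l) =
      (∏ k : Fin n, 2 ^ (k : ℕ)) * ∏ k : Fin n, ∏ l ∈ Iio k, symQInt q (2 * N + k + l) := by
    simp only [prod_mul_distrib, prod_const, Fin.card_Iio]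
  have hdiag : ∏ i : Fin n, ∏ l ∈ range (i + 1 : ℕ), symQInt q (2 * N + i + l) =
      (∏ k : Fin n, ∏ l ∈ Iio k, symQInt q (2 * N + k + l)) *
        ∏ k : Fin n, symQInt q (2 * (N + k)) := by
    rw [← prod_mul_distrib]
    refine prod_congr rfl fun i _ ↦ ?_
    rw [prod_range_succ, prod_Iio_val i fun l ↦ symQInt q (2 * N + i + l), mul_add,
      two_mul (i : ℤ), add_assoc]
  refine mul_left_cancel₀ hcol ?_
  rw [prod_mul_tilingGF_regionD hq0 hq hnu hN hmono (fun i ↦ (Nat.le_add_left _ _).trans (hge i))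
    hle, prod_div_distrib, prod_mul_distrib, prod_prod_range_eq_mul_prod_Ico q N hge, htwo,
    symProdP, hdiag, prod_pow, prod_mul_distrib (f := fun i ↦ ((4 : K) ^ h i)⁻¹)]
  ring

end TilingProduct

section Exponent

theorem two_mul_sum_range_add (c : ℤ) (m : ℕ) :
    2 * ∑ r ∈ range m, (c + r) = m * (2 * c + m - 1) := by
  induction m with
  | zero => simp
  | succ m ih =>
    rw [sum_range_succ, mul_add, ih]
    push_cast
    ring

theorem two_mul_bracketSum {a b : ℤ} (hab : a ≤ b + 1) :
    2 * bracketSum b a = (b + 1 - a) * (a + b) := by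
  have hcard : ((b + 1 - a).toNat : ℤ) = b + 1 - a := Int.toNat_of_nonneg (by lia)
  have hgauss := two_mul_sum_range_add a (b + 1 - a).toNat
  rw [bracketSum, Int.Icc_eq_finset_map, sum_map]
  refine hgauss.trans ?_
  rw [hcard]
  ring

theorem sum_sum_Ioi_sub {n : ℕ} (g : Fin n → ℤ) :
    ∑ i : Fin n, ∑ j ∈ Ioi i, (2 * (g j - g i) - 1) =
      ∑ i : Fin n, (2 * g i * (2 * i - n + 1) - i) := by
  have hswap : ∑ i : Fin n, ∑ j ∈ Ioi i, (2 * g j - 1) = ∑ j : Fin n, (j : ℤ) * (2 * g j - 1) := by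
    rw [sum_comm' (t' := univ) (s' := Iio) (by simp)]
    exact sum_congr rfl fun j _ ↦ by rw [sum_const, Fin.card_Iio, nsmul_eq_mul]
  have hconst (i : Fin n) : ∑ _j ∈ Ioi i, 2 * g i = (n - 1 - i) * (2 * g i) := by
    have := i.isLt
    rw [sum_const, Fin.card_Ioi, nsmul_eq_mul, Nat.cast_sub (by lia), Nat.cast_sub (by lia),
      Nat.cast_one]
  calc
    _ = ∑ i : Fin n, ∑ j ∈ Ioi i, (2 * g j - 1) - ∑ i : Fin n, ∑ _j ∈ Ioi i, 2 * g i := by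
      simp only [← sum_sub_distrib]
      exact sum_congr rfl fun i _ ↦ sum_congr rfl fun j _ ↦ by ring
    _ = _ := by
      rw [hswap, sum_congr rfl fun i _ ↦ hconst i, ← sum_sub_distrib]
      exact sum_congr rfl fun i _ ↦ by ring

theorem two_mul_expE {x u n X : ℕ} (hX : X + n = x + u) {h : Fin n → ℕ}
    (hnu : n ≤ u) (hge : ∀ i : Fin n, (i : ℕ) + 1 ≤ h i) :
    2 * expE x u 0 (![] : Fin 0 → ℕ) h =
      ∑ i : Fin n,
        (2 * (2 * X + 1 + i) + (2 * h i - i - 1) * (4 * X + 3 * i + 2 - 2 * h i) : ℤ) := by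
  have hf : 2 * fExp (2 * X + 1) n 1 = ∑ i : Fin n, 2 * (2 * X + 1 + i : ℤ) := by
    rw [two_mul_fExp, ← mul_sum, Fin.sum_univ_eq_sum_range fun i : ℕ ↦ (2 * X + 1 + i : ℤ),
      two_mul_sum_range_add]
    ring
  have hE : expE x u 0 (![] : Fin 0 → ℕ) h = fExp (2 * X + 1) n 1 +
      ∑ i : Fin n, bracketSum (2 * X + i) (2 * X + 2 * (i + 1) - 2 * h i) := by
    simp only [expE, univ_eq_empty, sum_empty, add_zero, Nat.cast_zero, mul_zero, sub_zero,
      zero_add]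
    rw [min_eq_right (by lia)]
    congr 1
    · congr 1
      lia
    · exact sum_congr rfl fun i _ ↦ congrArg₂ bracketSum (by lia) (by lia)
  rw [hE, mul_add, hf, mul_sum, ← sum_add_distrib]
  refine sum_congr rfl fun i _ ↦ ?_
  have := hge i
  rw [two_mul_bracketSum (by lia)]
  ring

theorem sum_range_expE_defect (n : ℕ) :
    ∑ i ∈ range n, (6 * (i + 1 : ℤ) ^ 2 - 2 * (i + 1) - 4 * n * (i + 1)) = 0 := by
  have hsum (m : ℕ) : ∑ i ∈ range m, (6 * (i + 1 : ℤ) ^ 2 - 2 * (i + 1) - 4 * n * (i + 1)) =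
      m * (m + 1) * (2 * m - 2 * n : ℤ) := by
    induction m with
    | zero => simp
    | succ m ih =>
      rw [sum_range_succ, ih]
      push_cast
      ring
  rw [hsum, sub_self, mul_zero]

theorem expE_eq_sum {x u n X : ℕ} (hX : X + n = x + u) {h : Fin n → ℕ}
    (hnu : n ≤ u) (hge : ∀ i : Fin n, (i : ℕ) + 1 ≤ h i) :
    expE x u 0 (![] : Fin 0 → ℕ) h =
      (∑ i : Fin n, ∑ j ∈ Ioi i, (2 * (h j - h i : ℤ) - 1)) -
        (∑ i : Fin n, ∑ r ∈ range (2 * h i), (r : ℤ)) +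
        (∑ i : Fin n, (2 * X + 2 * i + 1 : ℤ)) +
        (∑ i : Fin n, ∑ l ∈ range (i + 1 : ℕ), (2 * X + i + 1 + l : ℤ)) +
        ∑ i : Fin n, ∑ _r ∈ Ico (i + 1 : ℕ) (h i), (4 * X + 2 * n : ℤ) := by
  have hfact (i : Fin n) : 2 * ∑ r ∈ range (2 * h i), (r : ℤ) = 2 * h i * (2 * h i - 1) := by
    simpa using two_mul_sum_range_add 0 (2 * h i)
  have hbox (i : Fin n) : ∑ _r ∈ Ico (i + 1 : ℕ) (h i), (4 * X + 2 * n : ℤ) =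
      (h i - (i + 1)) * (4 * X + 2 * n) := by
    rw [sum_const, Nat.card_Ico, nsmul_eq_mul, Nat.cast_sub (hge i)]
    push_cast
    rfl
  have hdefect := sum_range_expE_defect n
  rw [← Fin.sum_univ_eq_sum_range
    fun i : ℕ ↦ (6 * (i + 1 : ℤ) ^ 2 - 2 * (i + 1) - 4 * n * (i + 1))] at hdefect
  refine mul_left_cancel₀ (two_ne_zero (α := ℤ)) ?_
  rw [two_mul_expE hX hnu hge, sum_sum_Ioi_sub, ← sub_eq_zero, ← neg_eq_zero, ← hdefect]
  simp only [mul_add, mul_sub, mul_sum (s := univ), hfact, hbox, two_mul_sum_range_add,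
    ← sum_add_distrib, ← sum_sub_distrib, ← sum_neg_distrib]
  refine sum_congr rfl fun i _ ↦ ?_
  push_cast
  ring

end Exponent

section Product

variable {K : Type*} [Field K] {q : K}

theorem prod_Icc_one_eq_prod_range {M : Type*} [CommMonoid M] (f : ℕ → M) (m : ℕ) :
    ∏ k ∈ Icc 1 m, f k = ∏ r ∈ range m, f (r + 1) := by
  rw [← Ico_add_one_right_eq_Icc, prod_Ico_eq_prod_range, Nat.add_sub_cancel]
  simp only [add_comm 1]

theorem prod_eq_zpow_sum_mul_prod {ι : Type*} (hq0 : q ≠ 0) {s : Finset ι} {e : ι → ℤ}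
    {a b : ι → K} (hab : ∀ i ∈ s, a i = q ^ e i * b i) :
    ∏ i ∈ s, a i = q ^ (∑ i ∈ s, e i) * ∏ i ∈ s, b i := by
  classical
  rw [prod_congr rfl hab, prod_mul_distrib]
  congr 1
  induction s using Finset.induction_on with
  | empty => simp
  | insert i s hi ih =>
    rw [prod_insert hi, sum_insert hi, zpow_add₀ hq0, ih fun j hj ↦ hab j (mem_insert_of_mem hj)]

theorem qInt_sq_eq_zpow_mul_symQInt_of_eq (hq0 : q ≠ 0) {m : ℕ} {e k : ℤ} (hk : (m : ℤ) = k)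
    (he : e = k - 1) : qInt (q ^ 2) m = q ^ e * symQInt q k := by
  rw [qInt_sq_eq_zpow_mul_symQInt hq0, he, hk]

theorem prod_qInt_sub (hq0 : q ≠ 0) {n : ℕ} {h : Fin n → ℕ} (hmono : StrictMono h) :
    ∏ i : Fin n, ∏ j ∈ Ioi i, qInt (q ^ 2) (2 * (h j - h i)) =
      q ^ (∑ i : Fin n, ∑ j ∈ Ioi i, (2 * (h j - h i : ℤ) - 1)) *
        ∏ i : Fin n, ∏ j ∈ Ioi i, symQInt q (2 * (h j - h i)) := by
  refine prod_eq_zpow_sum_mul_prod hq0 fun i _ ↦ prod_eq_zpow_sum_mul_prod hq0 fun j hj ↦ ?_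
  have := hmono (mem_Ioi.1 hj)
  exact qInt_sq_eq_zpow_mul_symQInt_of_eq hq0 (by lia) rfl

theorem prod_qFact (hq0 : q ≠ 0) {n : ℕ} (h : Fin n → ℕ) :
    ∏ i : Fin n, qFact (q ^ 2) (2 * h i) =
      q ^ (∑ i : Fin n, ∑ r ∈ range (2 * h i), (r : ℤ)) *
        ∏ i : Fin n, ∏ r ∈ range (2 * h i), symQInt q (r + 1) := by
  refine prod_eq_zpow_sum_mul_prod hq0 fun i _ ↦ ?_
  rw [qFact, prod_Icc_one_eq_prod_range]
  exact prod_eq_zpow_sum_mul_prod hq0 fun r _ ↦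
    qInt_sq_eq_zpow_mul_symQInt_of_eq hq0 (by lia) (by lia)

theorem prod_qInt_two_mul_add (hq0 : q ≠ 0) (X n : ℕ) :
    ∏ i ∈ Icc 1 n, qInt (q ^ 2) (2 * (X + i)) =
      q ^ (∑ i : Fin n, (2 * X + 2 * i + 1 : ℤ)) *
        ∏ i : Fin n, symQInt q (2 * (X + 1 + i)) := by
  rw [prod_Icc_one_eq_prod_range, prod_range]
  exact prod_eq_zpow_sum_mul_prod hq0 fun i _ ↦
    qInt_sq_eq_zpow_mul_symQInt_of_eq hq0 (by lia) (by lia)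

theorem prod_prod_qInt_add_add (hq0 : q ≠ 0) (X n : ℕ) :
    ∏ i ∈ Icc 1 n, ∏ j ∈ Icc 1 i, qInt (q ^ 2) (2 * X + i + j) =
      q ^ (∑ i : Fin n, ∑ l ∈ range (i + 1 : ℕ), (2 * X + i + 1 + l : ℤ)) *
        ∏ i : Fin n, ∏ l ∈ range (i + 1 : ℕ), symQInt q (2 * (X + 1) + i + l) := by
  rw [prod_Icc_one_eq_prod_range, prod_range]
  refine prod_eq_zpow_sum_mul_prod hq0 fun i _ ↦ ?_
  rw [prod_Icc_one_eq_prod_range]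
  exact prod_eq_zpow_sum_mul_prod hq0 fun l _ ↦
    qInt_sq_eq_zpow_mul_symQInt_of_eq hq0 (by lia) (by lia)

theorem prod_prod_qInt_mul_qInt (hq0 : q ≠ 0) {X n : ℕ} {h : Fin n → ℕ}
    (hle : ∀ i, h i ≤ X + n) :
    ∏ i : Fin n, ∏ j ∈ Icc 1 (h i - (i + 1)),
        qInt (q ^ 2) (2 * (X + (i + 1) + j)) * qInt (q ^ 2) (2 * (X + n - i - j)) =
      q ^ (∑ i : Fin n, ∑ _r ∈ Ico (i + 1 : ℕ) (h i), (4 * X + 2 * n : ℤ)) *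
        ∏ i : Fin n, ∏ r ∈ Ico (i + 1 : ℕ) (h i),
          symQInt q (2 * (X + 1 + r)) * symQInt q (2 * (X + 1 + (n - 1 - r))) := by
  refine prod_eq_zpow_sum_mul_prod hq0 fun i _ ↦ ?_
  rw [prod_Icc_one_eq_prod_range, prod_Ico_eq_prod_range, sum_Ico_eq_sum_range]
  refine prod_eq_zpow_sum_mul_prod hq0 fun r hr ↦ ?_
  have := mem_range.1 hr
  have := hle i
  rw [qInt_sq_eq_zpow_mul_symQInt_of_eq hq0 (k := 2 * (X + 1 + (i + 1 + r : ℕ))) (by lia) rfl,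
    qInt_sq_eq_zpow_mul_symQInt_of_eq hq0 (k := 2 * (X + 1 + (n - 1 - (i + 1 + r : ℕ)))) (by lia)
      rfl, mul_mul_mul_comm, ← zpow_add₀ hq0]
  congr 2
  ring

theorem two_zpow_neg_expF [NeZero (2 : K)] {n : ℕ} (h : Fin n → ℕ) :
    (2 : K) ^ (-expF (![] : Fin 0 → ℕ) h) = ∏ i : Fin n, (4 ^ h i)⁻¹ * 2 ^ (i : ℕ) := by
  have hF : -expF (![] : Fin 0 → ℕ) h = ∑ i : Fin n, (i - 2 * h i : ℤ) := by
    have hn : (n : ℤ) = ∑ _i : Fin n, 1 := by simp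
    simp only [expF, univ_eq_empty, sum_empty, Nat.cast_zero, zero_add, mul_one, add_zero]
    rw [hn, ← sum_add_distrib, ← sum_neg_distrib]
    exact sum_congr rfl fun i _ ↦ by ring
  have hfactor (i : Fin n) : (4 ^ h i : K)⁻¹ * 2 ^ (i : ℕ) = 2 ^ (i - 2 * h i : ℤ) * 1 := by
    rw [mul_one, zpow_sub₀ two_ne_zero, zpow_natCast, zpow_mul, zpow_natCast, div_eq_inv_mul]
    norm_num
  rw [prod_eq_zpow_sum_mul_prod two_ne_zero fun i _ ↦ hfactor i, prod_const_one, mul_one, hF]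

theorem prodP_eq_symProdP [NeZero (2 : K)] (hq0 : q ≠ 0) {x u n X : ℕ} (hnu : n ≤ u)
    (hX : X + n = x + u) {h : Fin n → ℕ} (hmono : StrictMono h)
    (hge : ∀ i : Fin n, (i : ℕ) + 1 ≤ h i) (hle : ∀ i, h i ≤ u) :
    prodP q x u 0 (![] : Fin 0 → ℕ) h = symProdP q (X + 1) h := by
  have hP : prodP q x u 0 (![] : Fin 0 → ℕ) h =
      2 ^ (-expF (![] : Fin 0 → ℕ) h) * q ^ (-expE x u 0 (![] : Fin 0 → ℕ) h) *
      ((∏ i : Fin n, ∏ j ∈ Ioi i, qInt (q ^ 2) (2 * (h j - h i))) /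
        ∏ i : Fin n, qFact (q ^ 2) (2 * h i)) *
      (∏ i ∈ Icc 1 n, qInt (q ^ 2) (2 * (X + i))) *
      (∏ i ∈ Icc 1 n, ∏ j ∈ Icc 1 i, qInt (q ^ 2) (2 * X + i + j)) *
      ∏ i : Fin n, ∏ j ∈ Icc 1 (h i - (i + 1)),
        qInt (q ^ 2) (2 * (X + (i + 1) + j)) * qInt (q ^ 2) (2 * (X + n - i - j)) := by
    obtain rfl : X = x + (u - n) := by lia
    simp [prodP]
  rw [hP, two_zpow_neg_expF, prod_qInt_sub hq0 hmono, prod_qFact hq0, prod_qInt_two_mul_add hq0,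
    prod_prod_qInt_add_add hq0, prod_prod_qInt_mul_qInt hq0 fun i ↦ (hle i).trans (by lia),
    expE_eq_sum hX hnu hge, neg_eq_zero_sub, zpow_sub₀ hq0, zpow_add₀ hq0, zpow_add₀ hq0,
    zpow_add₀ hq0, zpow_sub₀ hq0, symProdP]
  field_simp

end Product

theorem val_add_one_le_of_strictMono {n : ℕ} {h : Fin n → ℕ} (hmono : StrictMono h)
    (hpos : ∀ i, 1 ≤ h i) (i : Fin n) : (i : ℕ) + 1 ≤ h i := by
  have hmaps : Set.MapsTo h (Iic i) (Icc 1 (h i)) := fun j hj ↦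
    mem_coe.2 (mem_Icc.2 ⟨hpos j, hmono.monotone (mem_Iic.1 hj)⟩)
  simpa using card_le_card_of_injOn h hmaps hmono.injective.injOn

theorem mainTheorem10_general {K : Type*} [Field K] [NeZero (2 : K)] (q : K) (hq0 : q ≠ 0)
    (hq : ∀ k : ℕ, 1 ≤ k → qInt (q ^ 2) k ≠ 0) (x u n : ℕ) (h : Fin n → ℕ) (hmono : StrictMono h)
    (hmem : ∀ j, 1 ≤ h j ∧ h j ≤ u) :
    tilingGF (regionD x u h) (wt₂ q) = prodP q x u 0 (![] : Fin 0 → ℕ) h := by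
  have hge := val_add_one_le_of_strictMono hmono fun i ↦ (hmem i).1
  have hle (i : Fin n) : h i ≤ u := (hmem i).2
  have hnu : n ≤ u := by
    cases n with
    | zero => exact u.zero_le
    | succ n => exact (hge (Fin.last n)).trans (hle _)
  have hX : (x + (u - n)) + n = x + u := by lia
  rw [tilingGF_regionD_eq_symProdP hq0 hq hnu (N := x + (u - n) + 1) (by lia) hmono hge hle,
    prodP_eq_symProdP hq0 hnu hX hmono hge hle, Nat.cast_add_one]

theorem mainTheorem10 {K : Type*} [Field K] [CharZero K] (q : K) (hq0 : q ≠ 0)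
    (hq : ∀ k : ℕ, 1 ≤ k → qInt (q ^ 2) k ≠ 0)
    (x u n : ℕ) (hnu : n ≤ u) (h : Fin n → ℕ) (hmono : StrictMono h)
    (hmem : ∀ j, 1 ≤ h j ∧ h j ≤ u) :
    tilingGF (regionD x u h) (wt₂ q) = prodP q x u 0 (![] : Fin 0 → ℕ) h :=
  mainTheorem10_general q hq0 hq x u n h hmono hmem
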